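/- **Definitions.** For a subset $E$ of $\mathbb{R}^n$ and $r>0$ let $N_r(E)$ be the least number of sets of diameter at most $r$ that can cover $E$ ($\infty$ if there is no finite cover). The lower and upper box dimensions of $E$ are $$\underline{\dim}_{\mathrm B} E=\liminf_{r\to0}\frac{\log N_r(E)}{-\log r},\qquad \overline{\dim}_{\mathrm B} E=\limsup_{r\to0}\frac{\log N_r(E)}{-\log r},$$ and the packing dimension of $E$ is $$\dim_{\mathrm P} E=\inf\Big\{\sup_j\overline{\dim}_{\mathrm B}E_j : E\subseteq\bigcup_{j=1}^\infty E_j \text{ with } E_j \text{ compact}\Big\}.$$ The Assouad dimension of $E$ is $$\dim_{\mathrm A}E=\inf\Big\{\alpha : \exists\, C>0\ \ \forall\, 0<r<R\ \ \forall x\in E,\ N_r(B(x,R)\cap E)\le C\,(R/r)^\alpha\Big\},$$ and, for $\theta\in(0,1)$, its upper Assouad spectrum is $$\overline{\dim}_{\mathrm A}^{\theta}E=\inf\Big\{\alpha : \exists\, C>0\ \ \forall\, 0<r\le R^{1/\theta}<R<1\ \ \forall x\in E,\ N_r(B(x,R)\cap E)\le C\,(R/r)^\alpha\Big\}.$$ Let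 $G(n,m)$ be the Grassmannian of $m$-dimensional linear subspaces of $\mathbb{R}^n$ with its natural $O(n)$-invariant probability measure, and for $V\in G(n,m)$ let $\pi_V$ be orthogonal projection onto $V$. **Theorem.** Let $1\le m<n$ be integers, $\theta\in(0,1)$ and let $F\subseteq\mathbb{R}^n$ be non-empty. If $F$ is bounded then, for almost all $V\in G(n,m)$, $$\overline{\dim}_{\mathrm B}\,\pi_V F\ \ge\ \overline{\dim}_{\mathrm B} F-\max\big\{0,\ \overline{\dim}_{\mathrm A}^{\theta}F-m,\ (\dim_{\mathrm A}F-m)(1-\theta)\big\},$$ and, for almost all $V\in G(n,m)$, $$\underline{\dim}_{\mathrm B}\,\pi_V F\ \ge\ \underline{\dim}_{\mathrm B} F-\max\big\{0,\ \overline{\dim}_{\mathrm A}^{\theta}F-m,\ (\dim_{\mathrm A}F-m)(1-\theta)\big\}.$$ If $F$ is a Borel set (bounded or not) then, for almost all $V\in G(n,m)$, $$\dim_{\mathrm P}\pi_V F\ \ge\ \dim_{\mathrm P} F-\max\big\{0,\ \overline{\dim}_{\mathrm A}^{\theta}F-m,\ (\dim_{\mathrm A}F-m)(1-\theta)\big\}.$$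 -/

import Mathlib

open Filter Topology MeasureTheory Set

namespace ProjDim

noncomputable section

/-! ### Covering numbers and dimensions of sets -/

section Dimensions

variable {X : Type*} [MetricSpace X]

/-- `coveringNumber r F` is the least number of sets of diameter at most `r` that can cover `F`
(it is `⊤` if there is no finite cover). -/
def coveringNumber (r : ℝ) (F : Set X) : ℕ∞ :=
  ⨅ (𝒰 : Set (Set X)) (_ : (∀ U ∈ 𝒰, Metric.ediam U ≤ ENNReal.ofReal r) ∧ F ⊆ ⋃₀ 𝒰), 𝒰.encard

/-- The quotient `log N_r(F) / (- log r)`, as an extended real number. -/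
def boxRatio (F : Set X) (r : ℝ) : EReal :=
  ENNReal.log (coveringNumber r F : ENNReal) / ((-Real.log r : ℝ) : EReal)

/-- The upper box-counting dimension. -/
def upperBoxDim (F : Set X) : EReal :=
  limsup (boxRatio F) (𝓝[>] (0 : ℝ))

/-- The lower box-counting dimension. -/
def lowerBoxDim (F : Set X) : EReal :=
  liminf (boxRatio F) (𝓝[>] (0 : ℝ))

/-- The packing dimension: the infimum of `sup_j upperBoxDim (A j)` over all countable covers of `F`
by compact sets `A j`. -/
def packingDim (F : Set X) : EReal :=
  ⨅ (A : ℕ → Set X) (_ : (∀ j, IsCompact (A j)) ∧ F ⊆ ⋃ j, A j), ⨆ j, upperBoxDim (A j)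

/-- The Assouad dimension. -/
def assouadDim (F : Set X) : EReal :=
  ⨅ (α : ℝ) (_ : ∃ C : ℝ, 0 < C ∧ ∀ r R : ℝ, 0 < r → r < R → ∀ x ∈ F,
    (coveringNumber r (Metric.closedBall x R ∩ F) : ENNReal) ≤ ENNReal.ofReal (C * (R / r) ^ α)),
    (α : EReal)

/-- The upper Assouad spectrum at `θ`. -/
def upperAssouadSpectrum (θ : ℝ) (F : Set X) : EReal :=
  ⨅ (α : ℝ) (_ : ∃ C : ℝ, 0 < C ∧
    ∀ r R : ℝ, 0 < r → 0 < R → R < 1 → r ≤ R ^ (1 / θ) → ∀ x ∈ F,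
    (coveringNumber r (Metric.closedBall x R ∩ F) : ENNReal) ≤ ENNReal.ofReal (C * (R / r) ^ α)),
    (α : EReal)

end Dimensions

/-! ### The Grassmannian and its invariant measure -/

/-- Euclidean `n`-space. -/
abbrev Euc (n : ℕ) : Type := EuclideanSpace ℝ (Fin n)

/-- The Grassmannian `G(n, m)` of `m`-dimensional linear subspaces of `ℝⁿ`. -/
def Grassmannian (n m : ℕ) : Type :=
  {V : Submodule ℝ (Euc n) // Module.finrank ℝ V = m}

/-- Orthogonal projection onto `V`, as an operator on `ℝⁿ`. -/
def Grassmannian.proj {n m : ℕ} (V : Grassmannian n m) : Euc n →L[ℝ] Euc n :=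
  V.1.starProjection

/-- `G(n, m)` carries the topology given by the metric `‖π_V - π_W‖` (operator norm). -/
instance (n m : ℕ) : TopologicalSpace (Grassmannian n m) :=
  TopologicalSpace.induced Grassmannian.proj inferInstance

instance (n m : ℕ) : MeasurableSpace (Grassmannian n m) := borel _

instance (n m : ℕ) : BorelSpace (Grassmannian n m) := ⟨rfl⟩

instance (n : ℕ) : ContinuousStar (Euc n →L[ℝ] Euc n) :=
  ⟨(ContinuousLinearMap.adjoint : (Euc n →L[ℝ] Euc n) ≃ₗᵢ⋆[ℝ] (Euc n →L[ℝ] Euc n)).continuous⟩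

/-- The orthogonal group `O(n)`, as the group of linear operators `g` on `ℝⁿ` with
`g* g = g g* = 1`, with the operator norm topology and the Borel σ-algebra. -/
abbrev OrthGroup (n : ℕ) := unitary (Euc n →L[ℝ] Euc n)

instance (n : ℕ) : CompactSpace (OrthGroup n) := by
  have : ProperSpace (Euc n →L[ℝ] Euc n) := FiniteDimensional.proper ℝ _
  refine isCompact_iff_compactSpace.mp
    (Metric.isCompact_of_isClosed_isBounded isClosed_unitary ?_)
  refine isBounded_iff_forall_norm_le.mpr ⟨1, fun u hu => ?_⟩
  refine ContinuousLinearMap.opNorm_le_bound _ zero_le_one fun x => ?_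
  simpa using (Unitary.norm_map ⟨u, hu⟩ x).le

/-- The Haar probability measure on `O(n)`. -/
def orthHaar (n : ℕ) : Measure (OrthGroup n) :=
  Measure.haarMeasure ⊤

instance (n : ℕ) : IsProbabilityMeasure (orthHaar n) :=
  ⟨by simpa [orthHaar] using Measure.haarMeasure_self (K₀ := (⊤ : TopologicalSpace.PositiveCompacts
    (OrthGroup n)))⟩

/-- The action of `O(n)` on `G(n, m)`: `g` sends `V` to its image `g V`. -/
def Grassmannian.rotate {n m : ℕ} (g : OrthGroup n) (V : Grassmannian n m) : Grassmannian n m :=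
  ⟨V.1.map (Unitary.linearIsometryEquiv g).toLinearEquiv.toLinearMap,
    (LinearEquiv.finrank_map_eq _ V.1).trans V.2⟩

/-- The base point of `G(n, m)`: the span of the first `m` standard basis vectors. -/
def Grassmannian.base {n m : ℕ} (h : m ≤ n) : Grassmannian n m :=
  ⟨Submodule.span ℝ
    (Set.range fun i : Fin m => (EuclideanSpace.single (Fin.castLE h i) (1 : ℝ) : Euc n)), by
    have hli : LinearIndependent ℝ
        (fun i : Fin m => (EuclideanSpace.single (Fin.castLE h i) (1 : ℝ) : Euc n)) := by
      have := (EuclideanSpace.basisFun (Fin n) ℝ).orthonormal.linearIndependent.comp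
        (Fin.castLE h) (Fin.castLE_injective h)
      simpa [Function.comp_def] using this
    simpa using finrank_span_eq_card hli⟩

theorem Grassmannian.proj_rotate {n m : ℕ} (g : OrthGroup n) (V : Grassmannian n m) :
    (V.rotate g).proj = (g : Euc n →L[ℝ] Euc n) * V.proj * (star g : OrthGroup n) := by
  ext1 x
  have := Submodule.starProjection_map_apply (Unitary.linearIsometryEquiv g) V.1 x
  exact this

theorem Grassmannian.continuous_rotate {n m : ℕ} (V : Grassmannian n m) :
    Continuous fun g : OrthGroup n => V.rotate g := by
  refine continuous_induced_rng.mpr ?_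
  have : (Grassmannian.proj ∘ fun g : OrthGroup n => V.rotate g) = fun g : OrthGroup n =>
      (g : Euc n →L[ℝ] Euc n) * V.proj * (star g : OrthGroup n) :=
    funext fun g => Grassmannian.proj_rotate g V
  rw [this]
  fun_prop

/-- The natural invariant measure on `G(n, m)`: the image of the Haar probability measure on `O(n)`
under `g ↦ g V₀`, where `V₀` is the base point. -/
def grassmannMeasure {n m : ℕ} (h : m ≤ n) : Measure (Grassmannian n m) :=
  (orthHaar n).map fun g => (Grassmannian.base h).rotate g

instance {n m : ℕ} (h : m ≤ n) : IsProbabilityMeasure (grassmannMeasure h) :=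
  Measure.isProbabilityMeasure_map (Grassmannian.base h).continuous_rotate.measurable.aemeasurable

end

end ProjDim

open ProjDim

namespace ProjDim

/-! ### The probability that a projection is short -/

/-! Let `M` exceed the claimed loss and let `P` be a maximal `δ`-separated subset of a bounded `F`.
The Assouad exponent (radii `R < δ ^ θ`) and the spectrum exponent (larger radii) together give `#(P
∩ B(x, R)) * (δ / R) ^ m ≲ δ ^ (-M)` for all `R ≥ δ` (`exists_card_filter_mul_le`). Hence the
discrete energy `∑ y, min(1, δ / |x - y|) ^ m` is at most `δ ^ (-M)` up to a logarithm
(`sum_kernel_le`). A random projection brings `x` and `y` within `4δ` with probability `≲ min(1, δ /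
|x - y|) ^ m`, so the expected number of close pairs is at most `#P * δ ^ (-M)` up to a logarithm.
Markov and Borel–Cantelli along dyadic scales make this bound almost sure, with `M' > M` in place of
`M`. Cauchy–Schwarz turns few close pairs into `N_{2δ}(F) ≤ δ ^ (-M') * N_{4δ}(π_V F)` up to a
constant (`ae_eventually_coveringNumber_le`). Both box dimension bounds follow. For packing
dimension, `F` is a continuous image of Baire space. Given `s < dim_P F`, deleting the basic open
sets with small image leaves a closed set all of whose nonempty relatively open pieces have image of
upper box dimension above `s`. The box estimate holds for countably many pieces at once, and Baire's
theorem puts the projection of one piece inside a member of any given compact cover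
(`ae_le_packingDim_add`). -/

theorem exists_orthGroup_apply_eq {n : ℕ} {x y : Euc n} (h : ‖x‖ = ‖y‖) :
    ∃ g : OrthGroup n, (g : Euc n →L[ℝ] Euc n) x = y := by
  -- The reflection in the hyperplane orthogonal to `x - y` swaps the two vectors.
  refine ⟨Unitary.linearIsometryEquiv.symm ((ℝ ∙ (x - y))ᗮ.reflection), ?_⟩
  have := Submodule.reflection_sub h
  simpa using this

theorem Grassmannian.norm_proj_rotate {n m : ℕ} (g : OrthGroup n) (V : Grassmannian n m)
    (x : Euc n) :
    ‖(V.rotate g).proj x‖ = ‖V.proj (((g⁻¹ : OrthGroup n) : Euc n →L[ℝ] Euc n) x)‖ := by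
  rw [Grassmannian.proj_rotate]
  exact Unitary.norm_map g _

theorem Grassmannian.continuous_proj {n m : ℕ} :
    Continuous (Grassmannian.proj : Grassmannian n m → Euc n →L[ℝ] Euc n) :=
  continuous_induced_dom

theorem Grassmannian.measurableSet_norm_proj_le {n m : ℕ} (x : Euc n) (ρ : ℝ) :
    MeasurableSet {V : Grassmannian n m | ‖V.proj x‖ ≤ ρ} := by
  refine (isClosed_le ?_ continuous_const).measurableSet
  exact ((ContinuousLinearMap.apply ℝ (Euc n) x).continuous.comp
    Grassmannian.continuous_proj).norm

theorem Grassmannian.abs_apply_le_norm_proj_base {n m : ℕ} (h : m ≤ n) (y : Euc n) (i : Fin n)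
    (hi : (i : ℕ) < m) : |y i| ≤ ‖(Grassmannian.base h).proj y‖ := by
  have hmem : (EuclideanSpace.single i (1 : ℝ) : Euc n) ∈ (Grassmannian.base h).1 :=
    Submodule.subset_span ⟨⟨i, hi⟩, rfl⟩
  have h0 := (Grassmannian.base h).1.starProjection_inner_eq_zero y _ hmem
  have h1 : y i = (Grassmannian.base h).proj y i := by
    have : inner ℝ (EuclideanSpace.single i (1 : ℝ) : Euc n)
        (y - (Grassmannian.base h).1.starProjection y) = 0 := by
      rw [real_inner_comm]; exact h0
    rw [EuclideanSpace.inner_single_left] at this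
    simp only [map_one, one_mul, PiLp.sub_apply] at this
    exact sub_eq_zero.mp this
  rw [h1]
  exact PiLp.norm_apply_le ((Grassmannian.base h).proj y) i

/-- The set lies in a box of side `2ρ` in the first `m` coordinates and side `2` in the others. -/
theorem volume_ball_inter_slab_le {n m : ℕ} (h : m ≤ n) {ρ : ℝ} (hρ : 0 < ρ) :
    volume {y : Euc n | ‖y‖ ≤ 1 ∧ ‖(Grassmannian.base h).proj y‖ ≤ ρ} ≤
      ENNReal.ofReal (2 ^ n * ρ ^ m) := by
  set a : Fin n → ℝ := fun i => if (i : ℕ) < m then ρ else 1 with ha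
  have hsub : {y : Euc n | ‖y‖ ≤ 1 ∧ ‖(Grassmannian.base h).proj y‖ ≤ ρ} ⊆
      (WithLp.ofLp : Euc n → Fin n → ℝ) ⁻¹' (Icc (-a) a) := by
    rintro y ⟨hy1, hy2⟩
    have key : ∀ i, |y i| ≤ a i := fun i => by
      by_cases hi : (i : ℕ) < m
      · simpa [ha, hi] using (Grassmannian.abs_apply_le_norm_proj_base h y i hi).trans hy2
      · simpa [ha, hi] using (PiLp.norm_apply_le y i).trans hy1
    exact ⟨fun i => (abs_le.mp (key i)).1, fun i => (abs_le.mp (key i)).2⟩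
  refine (measure_mono hsub).trans ?_
  rw [(PiLp.volume_preserving_ofLp (Fin n)).measure_preimage
    measurableSet_Icc.nullMeasurableSet, Real.volume_Icc_pi, ← ENNReal.ofReal_prod_of_nonneg]
  · refine ENNReal.ofReal_le_ofReal (le_of_eq ?_)
    have : ∀ i, a i - (-a) i = 2 * a i := fun i => by simp only [Pi.neg_apply]; ring
    rw [Finset.prod_congr rfl fun i _ => this i]
    simp only [Finset.prod_mul_distrib, Finset.prod_const, Finset.card_univ,
      Fintype.card_fin, ha, Finset.prod_ite, one_pow, mul_one]
    rw [Fin.card_filter_val_lt, min_eq_right h]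
  · intro i _
    have : 0 < a i := by simp only [ha]; split_ifs <;> linarith
    simp; linarith

/-- The measure of the rotations whose inverse takes `x` to within `ρ` of `(ℝ ^ m)ᗮ`. -/
noncomputable def slabMeasure {n m : ℕ} (h : m ≤ n) (ρ : ℝ) (x : Euc n) : ENNReal :=
  orthHaar n {g | ‖(Grassmannian.base h).proj (((g⁻¹ : OrthGroup n) : Euc n →L[ℝ] Euc n) x)‖ ≤ ρ}

theorem continuous_proj_inv_apply {n m : ℕ} (V : Grassmannian n m) :
    Continuous fun p : OrthGroup n × Euc n =>
      ‖V.proj (((p.1⁻¹ : OrthGroup n) : Euc n →L[ℝ] Euc n) p.2)‖ := by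
  have h1 : Continuous fun p : OrthGroup n × Euc n =>
      ((p.1⁻¹ : OrthGroup n) : Euc n →L[ℝ] Euc n) :=
    continuous_subtype_val.comp continuous_fst.inv
  exact (V.proj.continuous.comp (h1.clm_apply continuous_snd)).norm

theorem grassmannMeasure_norm_proj_le_eq {n m : ℕ} (h : m ≤ n) (ρ : ℝ) (x : Euc n) :
    grassmannMeasure h {V | ‖V.proj x‖ ≤ ρ} = slabMeasure h ρ x := by
  rw [grassmannMeasure, Measure.map_apply (Grassmannian.base h).continuous_rotate.measurable
    (Grassmannian.measurableSet_norm_proj_le x ρ)]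
  simp only [preimage_ofPred_eq, Grassmannian.norm_proj_rotate]
  rfl

instance (n : ℕ) : (orthHaar n).IsMulLeftInvariant := by
  unfold orthHaar; infer_instance

theorem slabMeasure_eq_of_norm_eq {n m : ℕ} (h : m ≤ n) (ρ : ℝ) {x y : Euc n} (hxy : ‖x‖ = ‖y‖) :
    slabMeasure h ρ x = slabMeasure h ρ y := by
  obtain ⟨k, rfl⟩ := exists_orthGroup_apply_eq hxy
  unfold slabMeasure
  -- Translating by `k⁻¹` replaces `g⁻¹ x` by `g⁻¹ k x`, so left invariance suffices.
  rw [← measure_preimage_mul (orthHaar n) k⁻¹]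
  congr 1
  ext g
  simp [mul_inv_rev]

theorem slabMeasure_smul {n m : ℕ} (h : m ≤ n) {ρ t : ℝ} (ht : 0 < t) (x : Euc n) :
    slabMeasure h (t * ρ) (t • x) = slabMeasure h ρ x := by
  unfold slabMeasure
  congr 1
  ext g
  simp only [map_smul, norm_smul, Real.norm_eq_abs, abs_of_pos ht, mem_ofPred_eq]
  exact mul_le_mul_iff_right₀ ht

/-- Stretching `x` to length `‖y‖` also stretches the threshold `ρ`, by a factor at least `1`. -/
theorem slabMeasure_anti_of_norm_le {n m : ℕ} (h : m ≤ n) {ρ : ℝ} (hρ : 0 < ρ) {x y : Euc n}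
    (hx : x ≠ 0) (hxy : ‖x‖ ≤ ‖y‖) : slabMeasure h ρ y ≤ slabMeasure h ρ x := by
  have hx0 := norm_pos_iff.mpr hx
  have ht : 0 < ‖y‖ / ‖x‖ := div_pos (hx0.trans_le hxy) hx0
  rw [← slabMeasure_smul h ht x, slabMeasure_eq_of_norm_eq h _ (y := (‖y‖ / ‖x‖) • x)]
  · refine measure_mono fun g (hg : _ ≤ ρ) => ?_
    exact hg.trans (le_mul_of_one_le_left hρ.le ((one_le_div hx0).mpr hxy))
  · rw [norm_smul, Real.norm_eq_abs, abs_of_pos ht, div_mul_cancel₀ _ hx0.ne']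

/-- Fubini: for fixed `g` the isometry `g⁻¹` preserves the ball and volume, so each slice has the
volume of the same slab. -/
theorem lintegral_slabMeasure_le {n m : ℕ} (h : m ≤ n) {ρ : ℝ} (hρ : 0 < ρ) :
    ∫⁻ x in Metric.closedBall (0 : Euc n) 1, slabMeasure h ρ x ≤
      ENNReal.ofReal (2 ^ n * ρ ^ m) := by
  have hcl := isClosed_le (continuous_proj_inv_apply (Grassmannian.base h))
    (continuous_const (y := ρ))
  have hmeas : MeasurableSet {p : OrthGroup n × Euc n |
      ‖(Grassmannian.base h).proj (((p.1⁻¹ : OrthGroup n) : Euc n →L[ℝ] Euc n) p.2)‖ ≤ ρ} :=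
    hcl.measurableSet
  have hprod := Measure.prod_apply_symm
    (μ := orthHaar n) (ν := volume.restrict (Metric.closedBall (0 : Euc n) 1)) hmeas
  have hprod' := Measure.prod_apply
    (μ := orthHaar n) (ν := volume.restrict (Metric.closedBall (0 : Euc n) 1)) hmeas
  calc ∫⁻ x in Metric.closedBall (0 : Euc n) 1, slabMeasure h ρ x
      = _ := hprod.symm
    _ = _ := hprod'
    _ ≤ ∫⁻ _, ENNReal.ofReal (2 ^ n * ρ ^ m) ∂(orthHaar n) := by
      refine lintegral_mono fun g => ?_
      have hg : MeasurableSet (Prod.mk g ⁻¹' {p : OrthGroup n × Euc n |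
        ‖(Grassmannian.base h).proj (((p.1⁻¹ : OrthGroup n) : Euc n →L[ℝ] Euc n) p.2)‖ ≤ ρ}) :=
        measurable_prodMk_left hmeas
      refine le_trans (le_of_eq ?_) (volume_ball_inter_slab_le h hρ)
      rw [Measure.restrict_apply hg]
      have hS : MeasurableSet {y : Euc n | ‖y‖ ≤ 1 ∧ ‖(Grassmannian.base h).proj y‖ ≤ ρ} :=
        ((isClosed_le continuous_norm continuous_const).inter (isClosed_le
          (Grassmannian.base h).proj.continuous.norm continuous_const)).measurableSet
      rw [← ((Unitary.linearIsometryEquiv g⁻¹).measurePreserving).measure_preimage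
        hS.nullMeasurableSet]
      congr 1
      ext x
      simp only [mem_inter_iff, mem_preimage, mem_ofPred_eq, Metric.mem_closedBall,
        dist_zero_right, LinearIsometryEquiv.norm_map]
      exact and_comm
    _ = ENNReal.ofReal (2 ^ n * ρ ^ m) := by simp

/-- A random projection shrinks a vector of length `‖x‖` to length at most `ρ` with probability at
most a constant times `(ρ / ‖x‖) ^ m`. -/
theorem exists_grassmannMeasure_norm_proj_le {n m : ℕ} (h : m ≤ n) :
    ∃ c : ℝ, 0 < c ∧ ∀ ρ : ℝ, 0 < ρ → ∀ x : Euc n, x ≠ 0 →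
      grassmannMeasure h {V | ‖V.proj x‖ ≤ ρ} ≤ ENNReal.ofReal (c * (ρ / ‖x‖) ^ m) := by
  set v := volume (Metric.closedBall (0 : Euc n) 1) with hv
  have hv0 : 0 < v := Metric.measure_closedBall_pos _ _ one_pos
  have hvt : v ≠ ⊤ := measure_closedBall_lt_top.ne
  have hvr : 0 < v.toReal := ENNReal.toReal_pos hv0.ne' hvt
  refine ⟨2 ^ n / v.toReal, by positivity, fun ρ hρ x hx => ?_⟩
  have hx0 := norm_pos_iff.mpr hx
  rw [grassmannMeasure_norm_proj_le_eq, ← slabMeasure_smul h (inv_pos.mpr hx0)]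
  set u := ‖x‖⁻¹ • x
  have hu : ‖u‖ = 1 := norm_smul_inv_norm (𝕜 := ℝ) hx
  have hρ' : 0 < ‖x‖⁻¹ * ρ := by positivity
  -- A unit vector minimises `slabMeasure` over the nonzero points of the unit ball, so its value is
  -- at most the average over that ball.
  have hle : slabMeasure h (‖x‖⁻¹ * ρ) u * v ≤ ENNReal.ofReal (2 ^ n * (‖x‖⁻¹ * ρ) ^ m) := by
    refine le_trans ?_ (lintegral_slabMeasure_le h hρ')
    rw [← setLIntegral_const]
    have : Nontrivial (Euc n) := ⟨x, 0, hx⟩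
    refine lintegral_mono_ae ?_
    filter_upwards [ae_restrict_mem Metric.isClosed_closedBall.measurableSet,
      ae_restrict_of_ae (Measure.ae_ne volume (0 : Euc n))] with y hy hy0
    exact slabMeasure_anti_of_norm_le h hρ' hy0 (by simpa [hu] using hy)
  rw [← ENNReal.le_div_iff_mul_le (Or.inl hv0.ne') (Or.inl hvt)] at hle
  refine hle.trans (le_of_eq ?_)
  rw [← ENNReal.ofReal_toReal hvt, ← ENNReal.ofReal_div_of_pos hvr]
  congr 1
  rw [ENNReal.toReal_ofReal hvr.le]
  ring

/-! ### Covering numbers and separated sets -/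

section Covering

variable {X : Type*} [MetricSpace X]

theorem coveringNumber_mono {r : ℝ} {E F : Set X} (h : E ⊆ F) :
    coveringNumber r E ≤ coveringNumber r F :=
  le_iInf₂ fun 𝒰 h𝒰 => iInf₂_le 𝒰 ⟨h𝒰.1, h.trans h𝒰.2⟩

theorem coveringNumber_anti {r r' : ℝ} (h : r ≤ r') (F : Set X) :
    coveringNumber r' F ≤ coveringNumber r F :=
  le_iInf₂ fun 𝒰 h𝒰 => iInf₂_le 𝒰
    ⟨fun U hU => (h𝒰.1 U hU).trans (ENNReal.ofReal_le_ofReal h), h𝒰.2⟩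

/-- Cardinalities are integers: were a finite infimum not attained, every cover would have at least
one more set. -/
theorem exists_cover_encard_eq {r : ℝ} {F : Set X} (h : coveringNumber r F ≠ ⊤) :
    ∃ 𝒰 : Set (Set X), (∀ U ∈ 𝒰, Metric.ediam U ≤ ENNReal.ofReal r) ∧ F ⊆ ⋃₀ 𝒰 ∧
      𝒰.encard = coveringNumber r F := by
  by_contra! H
  refine h (ENat.add_one_le_iff h |>.mp ?_ |>.false.elim)
  refine le_iInf₂ fun 𝒰 h𝒰 => (ENat.add_one_le_iff h).mpr ?_
  exact lt_of_le_of_ne (iInf₂_le 𝒰 h𝒰) (H 𝒰 h𝒰.1 h𝒰.2).symm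

theorem dist_le_of_mem_of_ediam_le {r : ℝ} (hr : 0 ≤ r) {U : Set X} {p q : X}
    (hU : Metric.ediam U ≤ ENNReal.ofReal r) (hp : p ∈ U) (hq : q ∈ U) : dist p q ≤ r := by
  have := (Metric.edist_le_ediam_of_mem hp hq).trans hU
  rwa [edist_dist, ENNReal.ofReal_le_ofReal_iff hr] at this

/-- The separation is strict, so a set of diameter at most `r` holds at most one point of `P`. -/
theorem card_le_coveringNumber {r : ℝ} (hr : 0 ≤ r) {P : Finset X} {E : Set X}
    (hPE : ↑P ⊆ E) (hP : ∀ p ∈ P, ∀ q ∈ P, p ≠ q → r < dist p q) :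
    (P.card : ℕ∞) ≤ coveringNumber r E := by
  refine le_iInf₂ fun 𝒰 h𝒰 => ?_
  have hex : ∀ p ∈ (P : Set X), ∃ U ∈ 𝒰, p ∈ U := fun p hp => h𝒰.2 (hPE hp)
  choose! u hu hpu using hex
  rw [← Set.encard_coe_eq_coe_finsetCard]
  refine Set.encard_le_encard_of_injOn (f := u) hu fun p hp q hq hpq => ?_
  by_contra hne
  refine (hP p hp q hq hne).not_ge ?_
  exact dist_le_of_mem_of_ediam_le hr (h𝒰.1 _ (hu p hp)) (hpu p hp) (hpq ▸ hpu q hq)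

theorem coveringNumber_le_card {r : ℝ} {P : Finset X} {F : Set X}
    (hF : F ⊆ ⋃ p ∈ P, Metric.closedBall p r) : coveringNumber (2 * r) F ≤ P.card := by
  classical
  have hcov : (∀ U ∈ (fun p => Metric.closedBall p r) '' (P : Set X),
      Metric.ediam U ≤ ENNReal.ofReal (2 * r)) ∧
      F ⊆ ⋃₀ ((fun p => Metric.closedBall p r) '' (P : Set X)) := by
    refine ⟨?_, by rwa [Set.sUnion_image]⟩
    rintro _ ⟨p, -, rfl⟩
    refine Metric.ediam_le fun x hx y hy => ?_
    rw [edist_dist]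
    refine ENNReal.ofReal_le_ofReal ((dist_triangle_right x y p).trans ?_)
    rw [Metric.mem_closedBall] at hx hy
    linarith
  have hle : coveringNumber (2 * r) F ≤
      ((fun p => Metric.closedBall p r) '' (P : Set X)).encard :=
    iInf₂_le ((fun p => Metric.closedBall p r) '' (P : Set X)) hcov
  exact hle.trans ((Set.encard_image_le _ _).trans
    (Set.encard_coe_eq_coe_finsetCard P).le)

theorem exists_maximal_separated {r : ℝ} (hr : 0 < r) {F : Set X} (hF : TotallyBounded F) :
    ∃ P : Finset X, ↑P ⊆ F ∧ (∀ p ∈ P, ∀ q ∈ P, p ≠ q → r < dist p q) ∧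
      F ⊆ ⋃ p ∈ P, Metric.closedBall p r := by
  set ε : NNReal := ⟨r, hr.le⟩ with hε
  have hpack : Metric.packingNumber ε F ≠ ⊤ := by
    have h2 : ε / 2 ≠ 0 := by
      have : (0 : NNReal) < ε / 2 := half_pos (show (0 : NNReal) < ε from hr)
      exact this.ne'
    obtain ⟨N, -, hfin, hN⟩ := Metric.exists_finite_isCover_of_totallyBounded h2 hF
    have h3 := Metric.packingNumber_two_mul_le_externalCoveringNumber (ε / 2) F
    rw [mul_div_cancel₀ _ two_ne_zero] at h3
    exact ((h3.trans hN.externalCoveringNumber_le_encard).trans_lt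
      hfin.encard_lt_top).ne
  have hfin : (Metric.maximalSeparatedSet ε F).Finite := by
    rw [← Set.encard_ne_top_iff, Metric.encard_maximalSeparatedSet hpack]
    exact hpack
  refine ⟨hfin.toFinset, by simpa using Metric.maximalSeparatedSet_subset, ?_, ?_⟩
  · intro p hp q hq hpq
    have : (ε : ENNReal) < edist p q :=
      Metric.isSeparated_maximalSeparatedSet (hfin.mem_toFinset.mp hp)
      (hfin.mem_toFinset.mp hq) hpq
    rw [edist_dist] at this
    have h2 : (ε : ENNReal) = ENNReal.ofReal r := (ENNReal.ofReal_eq_coe_nnreal hr.le).symm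
    rw [h2] at this
    exact (ENNReal.ofReal_lt_ofReal_iff_of_nonneg hr.le).mp this
  · have := Metric.isCover_iff_subset_iUnion_closedBall.mp
      (Metric.isCover_maximalSeparatedSet hpack)
    simp only [Set.Finite.mem_toFinset]
    exact this

open Classical in
/-- Cauchy–Schwarz: if the image of `P` has few close pairs, then it is hard to cover. -/
theorem sq_card_le_coveringNumber_mul {Y : Type*} {r : ℝ} (hr : 0 ≤ r) (f : Y → X)
    {P : Finset Y} {F : Set Y} (hP : ↑P ⊆ F) :
    ((P.card : ENNReal)) ^ 2 ≤ (coveringNumber r (f '' F) : ENNReal) *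
      (((P ×ˢ P).filter fun p => dist (f p.1) (f p.2) ≤ r).card : ENNReal) := by
  rcases P.eq_empty_or_nonempty with rfl | hne
  · simp
  set Q := (P ×ˢ P).filter fun p => dist (f p.1) (f p.2) ≤ r with hQ
  -- In the infinite case a diagonal pair makes the other factor nonzero, so the product is `⊤`.
  by_cases htop : coveringNumber r (f '' F) = ⊤
  · obtain ⟨p, hp⟩ := hne
    have : Q.card ≠ 0 := Finset.card_ne_zero.mpr ⟨(p, p), by simp [hQ, hp, hr]⟩
    rw [htop]
    simp [ENNReal.top_mul, this]
  obtain ⟨𝒰, hdiam, hcov, hcard⟩ := exists_cover_encard_eq htop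
  have hfin : 𝒰.Finite := Set.encard_ne_top_iff.mp (hcard ▸ htop)
  have hex : ∀ p ∈ P, ∃ U ∈ 𝒰, f p ∈ U := fun p hp => hcov ⟨p, hP hp, rfl⟩
  choose! u hu hpu using hex
  have hmaps : ∀ p ∈ P, u p ∈ hfin.toFinset := fun p hp => hfin.mem_toFinset.mpr (hu p hp)
  have h1 : P.card = ∑ U ∈ hfin.toFinset, (P.filter fun p => u p = U).card :=
    Finset.card_eq_sum_card_fiberwise hmaps
  -- Two points assigned to the same covering set have images within `r`; the squared fibre sizes
  -- count such pairs.
  have h2 : ∑ U ∈ hfin.toFinset, (P.filter fun p => u p = U).card ^ 2 ≤ Q.card := by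
    have hmaps' : ∀ p ∈ (P ×ˢ P).filter (fun p => u p.1 = u p.2), u p.1 ∈ hfin.toFinset :=
      fun p hp => hmaps _ (Finset.mem_product.mp (Finset.mem_filter.mp hp).1).1
    calc _ = ((P ×ˢ P).filter fun p => u p.1 = u p.2).card := by
          rw [Finset.card_eq_sum_card_fiberwise hmaps']
          refine Finset.sum_congr rfl fun U _ => ?_
          rw [sq, ← Finset.card_product]
          congr 1
          ext p
          simp only [Finset.mem_product, Finset.mem_filter]
          constructor
          · rintro ⟨⟨h1, h2⟩, h3, h4⟩
            exact ⟨⟨⟨h1, h3⟩, h2.trans h4.symm⟩, h2⟩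
          · rintro ⟨⟨⟨h1, h3⟩, h5⟩, h2⟩
            exact ⟨⟨h1, h2⟩, h3, h5 ▸ h2⟩
      _ ≤ Q.card := by
          refine Finset.card_le_card fun p hp => ?_
          obtain ⟨hp1, hp2⟩ := Finset.mem_filter.mp hp
          obtain ⟨ha, hb⟩ := Finset.mem_product.mp hp1
          refine Finset.mem_filter.mpr ⟨hp1, ?_⟩
          exact dist_le_of_mem_of_ediam_le hr (hdiam _ (hu _ ha)) (hpu _ ha) (hp2 ▸ hpu _ hb)
  have h3 : P.card ^ 2 ≤ hfin.toFinset.card * Q.card := by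
    rw [h1]
    exact sq_sum_le_card_mul_sum_sq.trans (Nat.mul_le_mul_left _ h2)
  rw [← hcard, hfin.encard_eq_coe_toFinset_card]
  exact_mod_cast h3

end Covering

/-- If `g` takes values at least `g y` at no more than `A / g y` points, for every `y`, then the sum
of `g` is at most `A` times a harmonic sum. -/
theorem sum_le_mul_harmonic {ι : Type*} {A : ℝ} {g : ι → ℝ} (hg : ∀ y, 0 ≤ g y) (P : Finset ι)
    (h : ∀ y ∈ P, ((P.filter fun z => g y ≤ g z).card : ℝ) * g y ≤ A) :
    ∑ y ∈ P, g y ≤ A * (harmonic P.card : ℝ) := by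
  classical
  induction hn : P.card generalizing P with
  | zero => simp [Finset.card_eq_zero.mp hn]
  | succ k ih =>
    have hne : P.Nonempty := Finset.card_pos.mp (by omega)
    -- At the minimiser all `k + 1` points are counted, so `g y ≤ A / (k + 1)`; removing it leaves
    -- the hypothesis intact.
    obtain ⟨y, hy, hmin⟩ := P.exists_min_image g hne
    have hall : (P.filter fun z => g y ≤ g z) = P := Finset.filter_true_of_mem hmin
    have hy' := h y hy
    rw [hall, hn] at hy'
    have hk : (0 : ℝ) < ((k + 1 : ℕ) : ℝ) := by positivity
    have hgy : g y ≤ A * ((k + 1 : ℕ) : ℝ)⁻¹ := by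
      rw [← div_eq_mul_inv, le_div_iff₀ hk]; linarith
    have ih' := ih (P.erase y) (fun z hz => by
      refine le_trans ?_ (h z (Finset.mem_of_mem_erase hz))
      refine mul_le_mul_of_nonneg_right ?_ (hg z)
      exact_mod_cast Finset.card_le_card (Finset.filter_subset_filter _ (P.erase_subset y)))
      (by rw [Finset.card_erase_of_mem hy, hn]; rfl)
    rw [← Finset.sum_erase_add P g hy, harmonic_succ]
    push_cast at hgy ⊢
    linarith

/-! ### Counting points of a separated set in balls -/

section Exponents

variable {X : Type*} [MetricSpace X]

/-- `s` is admissible in the definition of the Assouad dimension of `F`. -/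
def IsAssouadExponent (F : Set X) (s : ℝ) : Prop :=
  ∃ C : ℝ, 0 < C ∧ ∀ r R : ℝ, 0 < r → r < R → ∀ x ∈ F,
    (coveringNumber r (Metric.closedBall x R ∩ F) : ENNReal) ≤ ENNReal.ofReal (C * (R / r) ^ s)

/-- `t` is admissible in the definition of the upper Assouad spectrum of `F` at `θ`. -/
def IsSpectrumExponent (θ : ℝ) (F : Set X) (t : ℝ) : Prop :=
  ∃ C : ℝ, 0 < C ∧ ∀ r R : ℝ, 0 < r → 0 < R → R < 1 → r ≤ R ^ (1 / θ) → ∀ x ∈ F,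
    (coveringNumber r (Metric.closedBall x R ∩ F) : ENNReal) ≤ ENNReal.ofReal (C * (R / r) ^ t)

theorem IsAssouadExponent.mono {E F : Set X} {s : ℝ} (h : IsAssouadExponent F s) (hEF : E ⊆ F) :
    IsAssouadExponent E s := by
  obtain ⟨C, hC, H⟩ := h
  refine ⟨C, hC, fun r R hr hR x hx => le_trans ?_ (H r R hr hR x (hEF hx))⟩
  exact_mod_cast coveringNumber_mono (inter_subset_inter_right _ hEF)

theorem IsSpectrumExponent.mono {θ : ℝ} {E F : Set X} {t : ℝ} (h : IsSpectrumExponent θ F t)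
    (hEF : E ⊆ F) : IsSpectrumExponent θ E t := by
  obtain ⟨C, hC, H⟩ := h
  refine ⟨C, hC, fun r R hr h0 h1 hR x hx => le_trans ?_ (H r R hr h0 h1 hR x (hEF hx))⟩
  exact_mod_cast coveringNumber_mono (inter_subset_inter_right _ hEF)

/-- A finite set whose distinct points are more than `δ` apart. -/
def SeparatedBy (δ : ℝ) (P : Finset X) : Prop :=
  ∀ p ∈ P, ∀ q ∈ P, p ≠ q → δ < dist p q

open Classical in
theorem SeparatedBy.card_filter_le {δ : ℝ} (hδ : 0 < δ) {F : Set X} {P : Finset X}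
    (hP : SeparatedBy δ P) (hPF : ↑P ⊆ F) {x : X} {R B : ℝ} (hB : 0 ≤ B)
    (h : (coveringNumber δ (Metric.closedBall x R ∩ F) : ENNReal) ≤ ENNReal.ofReal B) :
    ((P.filter fun z => dist z x ≤ R).card : ℝ) ≤ B := by
  have h1 : ((P.filter fun z => dist z x ≤ R).card : ℕ∞) ≤
      coveringNumber δ (Metric.closedBall x R ∩ F) := by
    refine card_le_coveringNumber hδ.le (fun z hz => ?_) fun p hp q hq =>
      hP p (Finset.mem_filter.mp hp).1 q (Finset.mem_filter.mp hq).1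
    obtain ⟨hz1, hz2⟩ := Finset.mem_filter.mp (Finset.mem_coe.mp hz)
    exact ⟨hz2, hPF hz1⟩
  have h2 : ((P.filter fun z => dist z x ≤ R).card : ENNReal) ≤ ENNReal.ofReal B := by
    refine le_trans ?_ h
    exact_mod_cast h1
  rw [← ENNReal.ofReal_natCast] at h2
  exact (ENNReal.ofReal_le_ofReal_iff hB).mp h2

/-- The exponent `e` will be `s - m` or `t - m`, of either sign. A nonpositive `e` gives a power at
most `1`, which is where `0 ≤ M` enters. -/
theorem rpow_le_rpow_neg {b δ a e M : ℝ} (hδ : 0 < δ) (hδ1 : δ ≤ 1) (hb0 : 0 < b)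
    (hb : e ≤ 0 → 1 ≤ b) (hba : b ≤ δ ^ (-a)) (hM : 0 ≤ M) (he : e * a ≤ M) :
    b ^ e ≤ δ ^ (-M) := by
  rcases le_or_gt e 0 with h | h
  · exact (Real.rpow_le_one_of_one_le_of_nonpos (hb h) h).trans
      (Real.one_le_rpow_of_pos_of_le_one_of_nonpos hδ hδ1 (by linarith))
  · calc b ^ e ≤ (δ ^ (-a)) ^ e := Real.rpow_le_rpow hb0.le hba h.le
      _ = δ ^ (-a * e) := (Real.rpow_mul hδ.le _ _).symm
      _ ≤ δ ^ (-M) := Real.rpow_le_rpow_of_exponent_ge hδ hδ1 (by linarith)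

open Classical in
/-- The two Assouad-type exponents bound the number of points of a separated set in balls of all
radii. -/
theorem exists_card_filter_mul_le {m : ℕ} {θ s t M : ℝ} (hθ₀ : 0 < θ) (hθ₁ : θ < 1)
    {F : Set X} (hF : TotallyBounded F) (hs : IsAssouadExponent F s)
    (ht : IsSpectrumExponent θ F t) (hM : 0 ≤ M) (htM : t - m ≤ M) (hsM : (s - m) * (1 - θ) ≤ M) :
    ∃ A δ₀ : ℝ, 0 < A ∧ 0 < δ₀ ∧ δ₀ < 1 ∧ ∀ δ, 0 < δ → δ ≤ δ₀ → ∀ P : Finset X, ↑P ⊆ F →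
      SeparatedBy δ P → ∀ x ∈ F, ∀ R, δ ≤ R →
      ((P.filter fun z => dist z x ≤ R).card : ℝ) * (δ / R) ^ m ≤ A * δ ^ (-M) := by
  obtain ⟨Cs, hCs, Hs⟩ := hs
  obtain ⟨Ct, hCt, Ht⟩ := ht
  -- The spectrum only sees radii below `1`; larger balls are handled by finitely many balls of
  -- radius `1 / 2`.
  obtain ⟨Q, hQF, -, hQ⟩ := exists_maximal_separated (r := 1 / 2) (by norm_num) hF
  -- This makes the pair `(δ, 1 / 2)` admissible for the spectrum whenever `δ ≤ δ₀`.
  set δ₀ : ℝ := (1 / 2 : ℝ) ^ (1 / θ) with hδ₀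
  have hθ' : 1 < 1 / θ := (one_lt_div hθ₀).mpr hθ₁
  have hδ₀h : δ₀ ≤ 1 / 2 := by
    calc δ₀ ≤ (1 / 2 : ℝ) ^ (1 : ℝ) :=
          Real.rpow_le_rpow_of_exponent_ge (by norm_num) (by norm_num) hθ'.le
      _ = 1 / 2 := Real.rpow_one _
  refine ⟨Cs * 2 ^ s + Ct + Q.card * Ct, δ₀, by positivity, by positivity, by linarith, ?_⟩
  intro δ hδ hδδ₀ P hPF hP x hx R hR
  have hδ1 : δ ≤ 1 := by linarith
  have hR0 : 0 < R := hδ.trans_le hR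
  have hpow : ∀ b : ℝ, 0 < b → ∀ e : ℝ, b ^ e * (b⁻¹) ^ m = b ^ (e - m) := fun b hb e => by
    rw [inv_pow, ← div_eq_mul_inv, Real.rpow_sub hb, Real.rpow_natCast]
  have hb1 : 1 ≤ R / δ := (one_le_div hδ).mpr hR
  have hb0 : 0 < R / δ := by positivity
  have hD : 0 < δ ^ (-M) := Real.rpow_pos_of_pos hδ _
  have hinv : δ / R = (R / δ)⁻¹ := (inv_div _ _).symm
  have hA1 : 0 < Cs * 2 ^ s := by positivity
  have hA3 : 0 ≤ Q.card * Ct := by positivity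
  have hm0 : (0 : ℝ) ≤ (δ / R) ^ m := by positivity
  have h1δ : ∀ a : ℝ, a ≤ 1 → a / δ ≤ δ ^ (-(1 : ℝ)) := fun a ha => by
    rw [Real.rpow_neg_one, div_eq_mul_inv]
    exact mul_le_of_le_one_left (by positivity) ha
  rcases lt_or_ge R (δ ^ θ) with hRθ | hRθ
  -- Small radii: `R / δ ≤ δ ^ (θ - 1)`. The radius is doubled because the Assouad condition needs
  -- `δ < R` strictly, while `R = δ` is allowed here.
  · have hcard := hP.card_filter_le hδ hPF (R := 2 * R) (B := Cs * (2 * R / δ) ^ s)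
      (by positivity) (Hs δ (2 * R) hδ (by linarith) x hx)
    have hcard' : ((P.filter fun z => dist z x ≤ R).card : ℝ) ≤ Cs * 2 ^ s * (R / δ) ^ s := by
      refine le_trans ?_ (hcard.trans (le_of_eq ?_))
      · exact_mod_cast Finset.card_le_card
          (Finset.monotone_filter_right P
            (fun z _ (hz : dist z x ≤ R) => hz.trans (by linarith : R ≤ 2 * R)))
      · rw [mul_div_assoc, Real.mul_rpow (by norm_num) hb0.le, mul_assoc]
    have hb : (R / δ) ^ (s - m) ≤ δ ^ (-M) := by
      refine rpow_le_rpow_neg (a := 1 - θ) hδ hδ1 hb0 (fun _ => hb1) ?_ hM hsM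
      rw [neg_sub, Real.rpow_sub_one hδ.ne']
      gcongr
    calc _ ≤ Cs * 2 ^ s * (R / δ) ^ s * (δ / R) ^ m := by gcongr
      _ = Cs * 2 ^ s * (R / δ) ^ (s - m) := by rw [hinv, mul_assoc, hpow _ hb0]
      _ ≤ Cs * 2 ^ s * δ ^ (-M) := by gcongr
      _ ≤ _ := by gcongr; linarith
  rcases lt_or_ge R 1 with hR1 | hR1
  · have hδR : δ ≤ R ^ (1 / θ) := by
      calc δ = (δ ^ θ) ^ (1 / θ) := by
            rw [← Real.rpow_mul hδ.le, mul_one_div_cancel hθ₀.ne', Real.rpow_one]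
        _ ≤ R ^ (1 / θ) := Real.rpow_le_rpow (by positivity) hRθ (by positivity)
    have hcard := hP.card_filter_le hδ hPF (B := Ct * (R / δ) ^ t)
      (by positivity) (Ht δ R hδ hR0 hR1 hδR x hx)
    have hb : (R / δ) ^ (t - m) ≤ δ ^ (-M) :=
      rpow_le_rpow_neg (a := 1) hδ hδ1 hb0 (fun _ => hb1) (h1δ R hR1.le) hM (by linarith)
    calc _ ≤ Ct * (R / δ) ^ t * (δ / R) ^ m := by gcongr
      _ = Ct * (R / δ) ^ (t - m) := by rw [hinv, mul_assoc, hpow _ hb0]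
      _ ≤ Ct * δ ^ (-M) := by gcongr
      _ ≤ _ := by gcongr; linarith
  · have hballs : ∀ q ∈ Q, ((P.filter fun z => dist z q ≤ 1 / 2).card : ℝ) ≤
        Ct * (1 / 2 / δ) ^ t := fun q hq =>
      hP.card_filter_le hδ hPF (by positivity)
        (Ht δ (1 / 2) hδ (by norm_num) (by norm_num) hδδ₀ q (hQF hq))
    have hcard : ((P.filter fun z => dist z x ≤ R).card : ℝ) ≤
        Q.card * (Ct * (1 / 2 / δ) ^ t) := by
      have hsub : (P.filter fun z => dist z x ≤ R) ⊆
          Q.biUnion fun q => P.filter fun z => dist z q ≤ 1 / 2 := fun z hz => by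
        have hzP := (Finset.mem_filter.mp hz).1
        have hz' := hQ (hPF hzP)
        simp only [mem_iUnion, Metric.mem_closedBall, exists_prop] at hz'
        obtain ⟨q, hq, hzq⟩ := hz'
        exact Finset.mem_biUnion.mpr ⟨q, hq, Finset.mem_filter.mpr ⟨hzP, hzq⟩⟩
      calc ((P.filter fun z => dist z x ≤ R).card : ℝ)
          ≤ ∑ q ∈ Q, ((P.filter fun z => dist z q ≤ 1 / 2).card : ℝ) := by
            exact_mod_cast (Finset.card_le_card hsub).trans Finset.card_biUnion_le
        _ ≤ ∑ _q ∈ Q, Ct * (1 / 2 / δ) ^ t := Finset.sum_le_sum hballs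
        _ = _ := by rw [Finset.sum_const, nsmul_eq_mul]
    have hc0 : (0 : ℝ) < 1 / 2 / δ := by positivity
    have hc1 : 1 ≤ 1 / 2 / δ := (one_le_div hδ).mpr (by linarith)
    have hb : (1 / 2 / δ) ^ (t - m) ≤ δ ^ (-M) :=
      rpow_le_rpow_neg (a := 1) hδ hδ1 hc0 (fun _ => hc1) (h1δ _ (by norm_num)) hM (by linarith)
    have hm' : (δ / R) ^ m ≤ ((1 / 2 / δ)⁻¹) ^ m := by
      rw [inv_div]
      gcongr
      linarith
    calc _ ≤ Q.card * (Ct * (1 / 2 / δ) ^ t) * ((1 / 2 / δ)⁻¹) ^ m := by gcongr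
      _ = Q.card * Ct * (1 / 2 / δ) ^ (t - m) := by rw [← hpow _ hc0]; ring
      _ ≤ Q.card * Ct * δ ^ (-M) := by gcongr
      _ ≤ _ := by gcongr; linarith

open Classical in
/-- The energy of the counting measure on a separated set. -/
theorem sum_kernel_le {m : ℕ} (hm : 1 ≤ m) {δ A : ℝ} (hδ : 0 < δ) {P : Finset X} {x : X}
    (h : ∀ R, δ ≤ R → ((P.filter fun z => dist z x ≤ R).card : ℝ) * (δ / R) ^ m ≤ A) :
    ∑ y ∈ P, (δ / max δ (dist y x)) ^ m ≤ A * (harmonic P.card : ℝ) := by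
  have hmax : ∀ y, 0 < max δ (dist y x) := fun y => hδ.trans_le (le_max_left _ _)
  -- The points where the kernel is at least its value at `y` lie in the ball of radius `max δ (dist
  -- y x)` about `x`.
  refine sum_le_mul_harmonic (fun y => by have := hmax y; positivity) P fun y _ => ?_
  refine le_trans ?_ (h (max δ (dist y x)) (le_max_left _ _))
  refine mul_le_mul_of_nonneg_right ?_ (by have := hmax y; positivity)
  refine Nat.cast_le.mpr (Finset.card_le_card (Finset.monotone_filter_right _ fun z _ hz => ?_))
  by_contra hlt
  have hlt' : max δ (dist y x) < max δ (dist z x) := (not_le.mp hlt).trans_le (le_max_right _ _)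
  refine not_lt.mpr hz ?_
  have hz0 := hmax z
  -- Strictness needs `m ≠ 0`: the zeroth power would be constant.
  exact pow_lt_pow_left₀ (div_lt_div_of_pos_left hδ (hmax y) hlt') (by positivity) (by omega)

end Exponents

/-! ### Covering numbers of random projections -/

section Projections

variable {n m : ℕ}

open Classical in
/-- The number of pairs of points of `P` whose projections to `V` are `ρ`-close. -/
noncomputable def closePairs (P : Finset (Euc n)) (ρ : ℝ) (V : Grassmannian n m) : ENNReal :=
  (((P ×ˢ P).filter fun p => dist (V.proj p.1) (V.proj p.2) ≤ ρ).card : ENNReal)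

theorem closePairs_eq_sum (P : Finset (Euc n)) (ρ : ℝ) (V : Grassmannian n m) :
    closePairs P ρ V =
      ∑ p ∈ P, ∑ q ∈ P, {V : Grassmannian n m | ‖V.proj (q - p)‖ ≤ ρ}.indicator 1 V := by
  classical
  rw [closePairs, Finset.card_filter, Nat.cast_sum, Finset.sum_product]
  refine Finset.sum_congr rfl fun p _ => Finset.sum_congr rfl fun q _ => ?_
  rw [dist_comm, dist_eq_norm, ← map_sub, Set.indicator_apply]
  simp only [mem_ofPred_eq, Pi.one_apply]
  split_ifs <;> simp

theorem measurable_closePairs (P : Finset (Euc n)) (ρ : ℝ) :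
    Measurable (closePairs P ρ : Grassmannian n m → ENNReal) := by
  have : (closePairs P ρ : Grassmannian n m → ENNReal) = fun V =>
      ∑ p ∈ P, ∑ q ∈ P, {V : Grassmannian n m | ‖V.proj (q - p)‖ ≤ ρ}.indicator 1 V :=
    funext (closePairs_eq_sum P ρ)
  rw [this]
  exact Finset.measurable_sum _ fun p _ => Finset.measurable_sum _ fun q _ =>
    measurable_one.indicator (Grassmannian.measurableSet_norm_proj_le _ _)

/-- Pairs within `δ` get the trivial bound `1`; the others get the short-projection estimate at `4 *
δ`, whence `4 ^ m`. -/
theorem exists_grassmannMeasure_le_kernel (h : m ≤ n) :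
    ∃ c : ℝ, 0 < c ∧ ∀ δ : ℝ, 0 < δ → ∀ p q : Euc n,
      grassmannMeasure h {V | ‖V.proj (q - p)‖ ≤ 4 * δ} ≤
        ENNReal.ofReal (c * (δ / max δ (dist q p)) ^ m) := by
  obtain ⟨c, hc, H⟩ := exists_grassmannMeasure_norm_proj_le h
  refine ⟨1 + c * 4 ^ m, by positivity, fun δ hδ p q => ?_⟩
  rcases le_or_gt (dist q p) δ with hd | hd
  · refine prob_le_one.trans ?_
    rw [max_eq_left hd, div_self hδ.ne', one_pow, mul_one, ← ENNReal.ofReal_one]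
    exact ENNReal.ofReal_le_ofReal (by have : 0 < c * 4 ^ m := by positivity
                                       linarith)
  · have hne : q - p ≠ 0 := by
      rw [← norm_pos_iff, ← dist_eq_norm]
      exact hδ.trans hd
    refine (H _ (by positivity) _ hne).trans (ENNReal.ofReal_le_ofReal ?_)
    rw [max_eq_right hd.le, dist_eq_norm, mul_div_assoc, mul_pow, ← mul_assoc]
    gcongr
    linarith

open Classical in
theorem exists_lintegral_closePairs_le (hm : 1 ≤ m) (h : m ≤ n) :
    ∃ c : ℝ, 0 < c ∧ ∀ (δ A : ℝ), 0 < δ → ∀ P : Finset (Euc n),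
      (∀ x ∈ P, ∀ R, δ ≤ R → ((P.filter fun z => dist z x ≤ R).card : ℝ) * (δ / R) ^ m ≤ A) →
      ∫⁻ V, closePairs P (4 * δ) V ∂(grassmannMeasure h) ≤
        ENNReal.ofReal (P.card * (c * (A * (harmonic P.card : ℝ)))) := by
  obtain ⟨c, hc, H⟩ := exists_grassmannMeasure_le_kernel h
  refine ⟨c, hc, fun δ A hδ P hP => ?_⟩
  have hmeas : ∀ p q : Euc n, MeasurableSet {V : Grassmannian n m | ‖V.proj (q - p)‖ ≤ 4 * δ} :=
    fun p q => Grassmannian.measurableSet_norm_proj_le _ _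
  have hker : ∀ p q : Euc n, 0 ≤ c * (δ / max δ (dist q p)) ^ m := fun p q => by
    have : 0 < max δ (dist q p) := hδ.trans_le (le_max_left _ _)
    positivity
  calc ∫⁻ V, closePairs P (4 * δ) V ∂(grassmannMeasure h)
      = ∑ p ∈ P, ∑ q ∈ P, grassmannMeasure h {V | ‖V.proj (q - p)‖ ≤ 4 * δ} := by
        simp_rw [closePairs_eq_sum]
        rw [lintegral_finsetSum _ fun p _ => Finset.measurable_sum _ fun q _ =>
          measurable_one.indicator (hmeas p q)]
        refine Finset.sum_congr rfl fun p _ => ?_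
        rw [lintegral_finsetSum _ fun q _ => measurable_one.indicator (hmeas p q)]
        exact Finset.sum_congr rfl fun q _ => lintegral_indicator_one (hmeas p q)
    _ ≤ ∑ p ∈ P, ∑ q ∈ P, ENNReal.ofReal (c * (δ / max δ (dist q p)) ^ m) :=
        Finset.sum_le_sum fun p _ => Finset.sum_le_sum fun q _ => H δ hδ p q
    _ = ∑ p ∈ P, ENNReal.ofReal (c * ∑ q ∈ P, (δ / max δ (dist q p)) ^ m) := by
        refine Finset.sum_congr rfl fun p _ => ?_
        rw [Finset.mul_sum, ENNReal.ofReal_sum_of_nonneg fun q _ => hker p q]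
    _ ≤ ∑ p ∈ P, ENNReal.ofReal (c * (A * (harmonic P.card : ℝ))) := by
        refine Finset.sum_le_sum fun p hp => ENNReal.ofReal_le_ofReal ?_
        exact mul_le_mul_of_nonneg_left (sum_kernel_le hm hδ (hP p hp)) hc.le
    _ = _ := by
        rw [Finset.sum_const, nsmul_eq_mul, ENNReal.ofReal_mul (Nat.cast_nonneg _),
          ENNReal.ofReal_natCast]

/-- The net bounds the left side by `P.card`; Cauchy–Schwarz bounds `P.card ^ 2`, and one factor
`P.card` cancels. -/
theorem coveringNumber_le_of_closePairs_lt {F : Set (Euc n)} {P : Finset (Euc n)} {δ B : ℝ}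
    (hδ : 0 < δ) (hPF : ↑P ⊆ F) (hcov : F ⊆ ⋃ p ∈ P, Metric.closedBall p δ)
    {V : Grassmannian n m}
    (hV : closePairs P (4 * δ) V ≤ ENNReal.ofReal (P.card * B)) :
    (coveringNumber (2 * δ) F : ENNReal) ≤
      ENNReal.ofReal B * (coveringNumber (4 * δ) (V.proj '' F) : ENNReal) := by
  have h1 : (coveringNumber (2 * δ) F : ENNReal) ≤ (P.card : ENNReal) := by
    exact_mod_cast coveringNumber_le_card hcov
  refine h1.trans ?_
  rcases Nat.eq_zero_or_pos P.card with h0 | h0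
  · simp [h0]
  have h2 := sq_card_le_coveringNumber_mul (r := 4 * δ) (by positivity) V.proj hPF
  have h3 : (P.card : ENNReal) * P.card ≤ P.card *
      (ENNReal.ofReal B * (coveringNumber (4 * δ) (V.proj '' F) : ENNReal)) := by
    rw [← sq]
    refine h2.trans ((mul_le_mul_right hV _).trans (le_of_eq ?_))
    rw [ENNReal.ofReal_mul (by positivity), ENNReal.ofReal_natCast]
    ring
  have hc0 : (P.card : ENNReal) ≠ 0 := by exact_mod_cast h0.ne'
  exact (ENNReal.mul_le_mul_iff_right hc0 (ENNReal.natCast_ne_top _)).mp h3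

/-- The harmonic factor costs less than any power of `δ`. -/
theorem exists_harmonic_le {B D ε : ℝ} (hB : 0 < B) (hD : 0 < D) (hε : 0 < ε) :
    ∃ K : ℝ, 0 < K ∧ ∀ δ : ℝ, 0 < δ → δ ≤ 1 → ∀ N : ℕ, (N : ℝ) ≤ B * δ ^ (-D) →
      (harmonic N : ℝ) ≤ K * δ ^ (-ε) := by
  -- With this exponent, `log N ≤ N ^ η / η` turns `δ ^ (-D)` into `δ ^ (-ε)`.
  have hη : 0 < ε / D := by positivity
  refine ⟨1 + B ^ (ε / D) / (ε / D), by positivity, fun δ hδ hδ1 N hN => ?_⟩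
  have h1 : (1 : ℝ) ≤ δ ^ (-ε) :=
    Real.one_le_rpow_of_pos_of_le_one_of_nonpos hδ hδ1 (by linarith)
  have h2 : (N : ℝ) ^ (ε / D) ≤ B ^ (ε / D) * δ ^ (-ε) := by
    calc (N : ℝ) ^ (ε / D) ≤ (B * δ ^ (-D)) ^ (ε / D) :=
          Real.rpow_le_rpow (by positivity) hN hη.le
      _ = B ^ (ε / D) * δ ^ (-ε) := by
          rw [Real.mul_rpow hB.le (by positivity), ← Real.rpow_mul hδ.le]
          congr 2
          field_simp
  calc (harmonic N : ℝ) ≤ 1 + Real.log N := harmonic_le_one_add_log N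
    _ ≤ δ ^ (-ε) + (N : ℝ) ^ (ε / D) / (ε / D) :=
        add_le_add h1 (Real.log_natCast_le_rpow_div N hη)
    _ ≤ δ ^ (-ε) + B ^ (ε / D) * δ ^ (-ε) / (ε / D) := by gcongr
    _ = _ := by ring

open Classical in
/-- Along `δ = 2 ^ (- k - 2)`, almost every projection eventually keeps all but a factor
`2 ^ (k * M')` of the covering number. -/
theorem ae_eventually_coveringNumber_le (hm : 1 ≤ m) (h : m ≤ n) {θ s t M M' : ℝ}
    (hθ₀ : 0 < θ) (hθ₁ : θ < 1) {F : Set (Euc n)} (hF : Bornology.IsBounded F)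
    (hFne : F.Nonempty) (hs : IsAssouadExponent F s) (ht : IsSpectrumExponent θ F t) (hM : 0 ≤ M)
    (htM : t - m ≤ M)
    (hsM : (s - m) * (1 - θ) ≤ M) (hMM' : M < M') :
    ∀ᵐ V ∂(grassmannMeasure h), ∀ᶠ k : ℕ in atTop,
      (coveringNumber ((1 / 2 : ℝ) ^ (k + 1)) F : ENNReal) ≤
        ENNReal.ofReal (((1 / 2 : ℝ) ^ k) ^ (-M')) *
          (coveringNumber ((1 / 2 : ℝ) ^ k) (V.proj '' F) : ENNReal) := by
  have hFt : TotallyBounded F :=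
    (Bornology.IsBounded.isCompact_closure hF).totallyBounded.subset subset_closure
  obtain ⟨A, δ₀, hA, hδ₀, hδ₀1, hcount⟩ :=
    exists_card_filter_mul_le hθ₀ hθ₁ hFt hs ht hM htM hsM
  obtain ⟨c, hc, hint⟩ := exists_lintegral_closePairs_le (n := n) hm h
  obtain ⟨R, hR1, hR⟩ : ∃ R : ℝ, 1 ≤ R ∧ ∀ x ∈ F, ∀ y ∈ F, dist y x ≤ R := by
    obtain ⟨C, hC⟩ := Metric.isBounded_iff.mp hF
    exact ⟨max 1 C, le_max_left _ _, fun x hx y hy => (hC hy hx).trans (le_max_right _ _)⟩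
  have hmpos : (0 : ℝ) < m := by exact_mod_cast hm
  -- Half of the gap absorbs the harmonic factor; the other half gives geometric decay for
  -- Borel–Cantelli.
  set ε : ℝ := (M' - M) / 2 with hε
  have hε0 : 0 < ε := by rw [hε]; linarith
  obtain ⟨K, hK, hharm⟩ := exists_harmonic_le (B := A * R ^ m) (D := M + m) (ε := ε)
    (by positivity) (by linarith) hε0
  set δ : ℕ → ℝ := fun k => (1 / 2 : ℝ) ^ k / 4 with hδ
  have hδpos : ∀ k, 0 < δ k := fun k => by simp only [hδ]; positivity
  have hδ1 : ∀ k, δ k ≤ 1 := fun k => by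
    have : (1 / 2 : ℝ) ^ k ≤ 1 := pow_le_one₀ (by norm_num) (by norm_num)
    simp only [hδ]; linarith
  have hδlim : ∀ᶠ k in atTop, δ k ≤ δ₀ := by
    have : Tendsto δ atTop (𝓝 0) := by
      simpa [hδ] using (tendsto_pow_atTop_nhds_zero_of_lt_one (r := (1 / 2 : ℝ))
        (by norm_num) (by norm_num)).div_const 4
    exact (this.eventually (gt_mem_nhds hδ₀)).mono fun k hk => le_of_lt hk
  obtain ⟨k₀, hk₀⟩ := eventually_atTop.mp hδlim
  choose P hPF hPsep hPcov using fun k => exists_maximal_separated (hδpos k) hFt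
  set S : ℕ → Set (Grassmannian n m) := fun k =>
    {V | ENNReal.ofReal ((P k).card * ((1 / 2 : ℝ) ^ k) ^ (-M')) ≤ closePairs (P k) (4 * δ k) V}
    with hS
  set G : ℝ := c * A * K * (1 / 4 : ℝ) ^ (-(M + ε)) with hG
  have hbound : ∀ k, k₀ ≤ k → (P k).Nonempty →
      grassmannMeasure h (S k) ≤ ENNReal.ofReal (G * ((1 / 2 : ℝ) ^ ε) ^ k) := by
    intro k hk hne
    have hcard : (0 : ℝ) < (P k).card := by exact_mod_cast hne.card_pos
    have hcnt := fun x (hx : x ∈ P k) => hcount (δ k) (hδpos k) (hk₀ k hk) (P k) (hPF k)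
      (hPsep k) x (hPF k hx)
    obtain ⟨x₀, hx₀⟩ := hne
    -- The ball of radius `R` about `x₀` contains all of `P k`, so the counting bound controls its
    -- cardinality.
    have hN : ((P k).card : ℝ) ≤ A * R ^ m * δ k ^ (-(M + m)) := by
      have hδR : δ k ≤ R := (hδ1 k).trans hR1
      have h1 := hcnt x₀ hx₀ R hδR
      rw [Finset.filter_true_of_mem fun z hz => hR x₀ (hPF k hx₀) z (hPF k hz)] at h1
      have h2 : ((P k).card : ℝ) = (P k).card * (δ k / R) ^ m * (R ^ m * (δ k ^ m)⁻¹) := by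
        rw [div_pow]
        have := (hδpos k).ne'
        field_simp
      have h3 : δ k ^ (-(M + m)) = δ k ^ (-M) * (δ k ^ m)⁻¹ := by
        rw [neg_add, Real.rpow_add (hδpos k), Real.rpow_neg (hδpos k).le m, Real.rpow_natCast]
      rw [h2, h3]
      have : 0 < R ^ m * (δ k ^ m)⁻¹ := by have := hδpos k; positivity
      calc _ ≤ A * δ k ^ (-M) * (R ^ m * (δ k ^ m)⁻¹) := by gcongr
        _ = _ := by ring
    have hI := hint (δ k) _ (hδpos k) (P k) hcnt
    have hH := hharm (δ k) (hδpos k) (hδ1 k) _ hN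
    set w : ℝ := (P k).card * ((1 / 2 : ℝ) ^ k) ^ (-M') with hw
    have hw0 : 0 < w := by positivity
    have hmarkov := mul_meas_ge_le_lintegral₀ (μ := grassmannMeasure h)
      (measurable_closePairs (P k) (4 * δ k)).aemeasurable (ENNReal.ofReal w)
    have hle : ENNReal.ofReal w * grassmannMeasure h (S k) ≤
        ENNReal.ofReal (w * (G * ((1 / 2 : ℝ) ^ ε) ^ k)) := by
      refine (hmarkov.trans hI).trans (ENNReal.ofReal_le_ofReal ?_)
      have hd : 0 < δ k ^ (-M) := Real.rpow_pos_of_pos (hδpos k) _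
      calc ((P k).card : ℝ) * (c * (A * δ k ^ (-M) * (harmonic (P k).card : ℝ)))
          ≤ (P k).card * (c * (A * δ k ^ (-M) * (K * δ k ^ (-ε)))) := by gcongr
        _ = (P k).card * (c * A * K * δ k ^ (-(M + ε))) := by
            rw [neg_add, Real.rpow_add (hδpos k)]; ring
        _ = w * (G * ((1 / 2 : ℝ) ^ ε) ^ k) := by
            have h0 : (0 : ℝ) < (1 / 2 : ℝ) ^ k := by positivity
            have e1 : δ k ^ (-(M + ε)) =
                ((1 / 2 : ℝ) ^ k) ^ (-(M + ε)) * (1 / 4 : ℝ) ^ (-(M + ε)) := by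
              rw [← Real.mul_rpow h0.le (by norm_num)]
              simp only [hδ]
              congr 1
              ring
            have e2 : ((1 / 2 : ℝ) ^ k) ^ (-(M + ε)) =
                ((1 / 2 : ℝ) ^ k) ^ (-M') * ((1 / 2 : ℝ) ^ ε) ^ k := by
              rw [← Real.rpow_mul_natCast (by norm_num) ε k, mul_comm ε, Real.rpow_natCast_mul
                (by norm_num), ← Real.rpow_add h0]
              congr 1
              rw [hε]; ring
            rw [e1, e2, hw, hG]
            ring
    rw [ENNReal.ofReal_mul hw0.le] at hle
    exact (ENNReal.mul_le_mul_iff_right (ENNReal.ofReal_pos.mpr hw0).ne'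
      ENNReal.ofReal_ne_top).mp hle
  have hgeom : ∑' k, ENNReal.ofReal (G * ((1 / 2 : ℝ) ^ ε) ^ k) ≠ ⊤ := by
    have hq : (1 / 2 : ℝ) ^ ε < 1 := Real.rpow_lt_one (by norm_num) (by norm_num) hε0
    have hsum : Summable fun k : ℕ => G * ((1 / 2 : ℝ) ^ ε) ^ k :=
      (summable_geometric_of_lt_one (by positivity) hq).mul_left G
    exact hsum.tsum_ofReal_ne_top
  have hPne : ∀ k, (P k).Nonempty := fun k => by
    obtain ⟨x, hx⟩ := hFne
    have := hPcov k hx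
    simp only [mem_iUnion] at this
    obtain ⟨p, hp, -⟩ := this
    exact ⟨p, hp⟩
  have hBC := ae_eventually_notMem (μ := grassmannMeasure h) (s := fun k => S (k + k₀)) (by
    refine ne_top_of_le_ne_top hgeom ?_
    refine le_trans (ENNReal.tsum_le_tsum fun k => hbound (k + k₀) (by omega) (hPne _)) ?_
    exact ENNReal.tsum_comp_le_tsum_of_injective (add_left_injective k₀)
      fun k => ENNReal.ofReal (G * ((1 / 2 : ℝ) ^ ε) ^ k))
  filter_upwards [hBC] with V hV
  rw [← map_add_atTop_eq_nat k₀, eventually_map]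
  filter_upwards [hV] with k hk
  set j := k + k₀
  have hlt : closePairs (P j) (4 * δ j) V ≤
      ENNReal.ofReal ((P j).card * ((1 / 2 : ℝ) ^ j) ^ (-M')) := (not_le.mp hk).le
  have := coveringNumber_le_of_closePairs_lt (hδpos j) (hPF j) (hPcov j) hlt
  have e1 : 2 * δ j = (1 / 2 : ℝ) ^ (j + 1) := by simp only [hδ]; ring
  have e2 : 4 * δ j = (1 / 2 : ℝ) ^ j := by simp only [hδ]; ring
  rwa [e1, e2] at this

end Projections

/-! ### Box dimensions of projections -/

theorem boxRatio_mono {X Y : Type*} [MetricSpace X] [MetricSpace Y] {E : Set X} {F : Set Y} {r : ℝ}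
    (hr : 0 < r) (hr1 : r < 1) (h : coveringNumber r E ≤ coveringNumber r F) :
    boxRatio E r ≤ boxRatio F r := by
  refine EReal.div_le_div_right_of_nonneg ?_ (ENNReal.log_monotone (by exact_mod_cast h))
  exact_mod_cast (neg_pos.mpr (Real.log_neg hr hr1)).le

theorem eventually_pos_lt_one : ∀ᶠ r : ℝ in 𝓝[>] 0, 0 < r ∧ r < 1 :=
  Ioo_mem_nhdsGT one_pos

theorem upperBoxDim_mono {X : Type*} [MetricSpace X] {E F : Set X} (h : E ⊆ F) :
    upperBoxDim E ≤ upperBoxDim F :=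
  limsup_le_limsup (eventually_pos_lt_one.mono fun _ hr =>
    boxRatio_mono hr.1 hr.2 (coveringNumber_mono h))

theorem boxRatio_le_add {X Y : Type*} [MetricSpace X] [MetricSpace Y] {E : Set X} {F : Set Y}
    {r M : ℝ} (hr : 0 < r) (hr1 : r < 1)
    (h : (coveringNumber r E : ENNReal) ≤ ENNReal.ofReal (r ^ (-M)) * coveringNumber r F) :
    boxRatio E r ≤ (M : EReal) + boxRatio F r := by
  have hL : 0 < -Real.log r := neg_pos.mpr (Real.log_neg hr hr1)
  have hL' : (0 : EReal) ≤ ((-Real.log r : ℝ) : EReal) := by exact_mod_cast hL.le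
  have h1 := ENNReal.log_monotone h
  rw [ENNReal.log_mul_add, ENNReal.log_ofReal_of_pos (by positivity), Real.log_rpow hr] at h1
  refine (EReal.div_le_div_right_of_nonneg hL' h1).trans (le_of_eq ?_)
  have h2 : (M : EReal) = ((-M * Real.log r : ℝ) : EReal) / ((-Real.log r : ℝ) : EReal) := by
    rw [← EReal.coe_div]
    congr 1
    rw [eq_div_iff hL.ne']
    ring
  rw [boxRatio, h2, div_eq_mul_inv, div_eq_mul_inv, div_eq_mul_inv, ← EReal.coe_inv]
  exact EReal.right_distrib_of_nonneg_of_ne_top (by exact_mod_cast (inv_pos.mpr hL).le)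
    (EReal.coe_ne_top _) _ _

theorem upperBoxDim_le_add {X Y : Type*} [MetricSpace X] [MetricSpace Y] {E : Set X} {F : Set Y}
    {M : ℝ} (h : ∀ᶠ r in 𝓝[>] (0 : ℝ), boxRatio E r ≤ (M : EReal) + boxRatio F r) :
    upperBoxDim E ≤ upperBoxDim F + M := by
  have h1 : limsup (fun _ : ℝ => (M : EReal)) (𝓝[>] (0 : ℝ)) = M := limsup_const _
  rw [add_comm, upperBoxDim, upperBoxDim, ← h1]
  refine (limsup_le_limsup h).trans (EReal.limsup_add_le ?_ ?_)
  · left; rw [h1]; exact EReal.coe_ne_bot _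
  · left; rw [h1]; exact EReal.coe_ne_top _

theorem lowerBoxDim_le_add {X Y : Type*} [MetricSpace X] [MetricSpace Y] {E : Set X} {F : Set Y}
    {M : ℝ} (h : ∀ᶠ r in 𝓝[>] (0 : ℝ), boxRatio E r ≤ (M : EReal) + boxRatio F r) :
    lowerBoxDim E ≤ lowerBoxDim F + M := by
  have h1 : limsup (fun _ : ℝ => (M : EReal)) (𝓝[>] (0 : ℝ)) = M := limsup_const _
  rw [add_comm, lowerBoxDim, lowerBoxDim, ← h1]
  refine (liminf_le_liminf h).trans (EReal.liminf_add_le ?_ ?_)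
  · left; rw [h1]; exact EReal.coe_ne_bot _
  · left; rw [h1]; exact EReal.coe_ne_top _

/-- Comparing covering numbers along powers of `1 / 2` suffices. -/
theorem eventually_boxRatio_le_add {X Y : Type*} [MetricSpace X] [MetricSpace Y] {E : Set X}
    {F : Set Y} {M : ℝ} (hM : 0 ≤ M)
    (h : ∀ᶠ k : ℕ in atTop, (coveringNumber ((1 / 2 : ℝ) ^ (k + 1)) E : ENNReal) ≤
      ENNReal.ofReal (((1 / 2 : ℝ) ^ k) ^ (-M)) * coveringNumber ((1 / 2 : ℝ) ^ k) F) :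
    ∀ᶠ r in 𝓝[>] (0 : ℝ), boxRatio E r ≤ (M : EReal) + boxRatio F r := by
  obtain ⟨k₀, hk₀⟩ := eventually_atTop.mp h
  have hsmall : ∀ᶠ r : ℝ in 𝓝[>] 0, 0 < r ∧ r < (1 / 2 : ℝ) ^ k₀ :=
    Ioo_mem_nhdsGT (by positivity)
  filter_upwards [hsmall, eventually_pos_lt_one] with r hr hr1
  -- With `2 ^ (-(k + 1)) < r ≤ 2 ^ (-k)`, monotonicity bounds `N_r(E)` above at the finer scale and
  -- `N_r(F)` below at the coarser one.
  obtain ⟨k, hk1, hk2⟩ := exists_nat_pow_near_of_lt_one (y := (1 / 2 : ℝ)) hr.1 hr1.2.le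
    (by norm_num) (by norm_num)
  have hk : k₀ ≤ k := by
    by_contra hlt
    have : (1 / 2 : ℝ) ^ k₀ ≤ (1 / 2 : ℝ) ^ (k + 1) :=
      pow_le_pow_of_le_one (by norm_num) (by norm_num) (by omega)
    linarith [hr.2]
  refine boxRatio_le_add hr.1 hr1.2 ?_
  calc (coveringNumber r E : ENNReal) ≤ coveringNumber ((1 / 2 : ℝ) ^ (k + 1)) E := by
        exact_mod_cast coveringNumber_anti hk1.le E
    _ ≤ ENNReal.ofReal (((1 / 2 : ℝ) ^ k) ^ (-M)) * coveringNumber ((1 / 2 : ℝ) ^ k) F := hk₀ k hk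
    _ ≤ ENNReal.ofReal (r ^ (-M)) * coveringNumber r F := by
        refine mul_le_mul' (ENNReal.ofReal_le_ofReal ?_) ?_
        · exact Real.rpow_le_rpow_of_nonpos hr.1 hk2 (by linarith)
        · exact_mod_cast coveringNumber_anti hk2 F

/-- Rational `q` suffice, so only countably many null sets are discarded. -/
theorem sub_le_of_forall_rat_lt {x y M : EReal} (hM : M ≠ ⊥)
    (h : ∀ q : ℚ, M < ((q : ℝ) : EReal) → x ≤ y + ((q : ℝ) : EReal)) : x - M ≤ y := by
  induction M with
  | bot => exact absurd rfl hM
  | top => simp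
  | coe a =>
    obtain ⟨q₀, hq₀⟩ := exists_rat_gt a
    induction y with
    | top => exact le_top
    | bot =>
      have := h q₀ (by exact_mod_cast hq₀)
      rw [EReal.bot_add, le_bot_iff] at this
      simp [this]
    | coe b =>
      induction x with
      | bot => simp
      | top =>
        have := h q₀ (by exact_mod_cast hq₀)
        rw [← EReal.coe_add, top_le_iff] at this
        exact absurd this (EReal.coe_ne_top _)
      | coe c =>
        rw [← EReal.coe_sub, EReal.coe_le_coe_iff]
        by_contra! hlt
        obtain ⟨q, hq1, hq2⟩ := exists_rat_btwn (show a < c - b by linarith)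
        have := h q (by exact_mod_cast hq1)
        rw [← EReal.coe_add, EReal.coe_le_coe_iff] at this
        linarith

/-! ### Extracting real exponents from the infima -/

section Exponents

variable {X : Type*} [MetricSpace X] {F : Set X}

theorem exists_isAssouadExponent {m : ℕ} {θ q : ℝ} (hθ : θ < 1)
    (h : (assouadDim F - (m : EReal)) * ((1 - θ : ℝ) : EReal) < (q : EReal)) :
    ∃ s, IsAssouadExponent F s ∧ (s - m) * (1 - θ) ≤ q := by
  have hθ' : 0 < 1 - θ := by linarith
  have hlt : assouadDim F < ((q / (1 - θ) + m : ℝ) : EReal) := by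
    by_contra! hle
    refine h.not_ge ?_
    have h1 := mul_le_mul_of_nonneg_right (EReal.sub_le_sub hle (le_refl (m : EReal)))
      (show (0 : EReal) ≤ ((1 - θ : ℝ) : EReal) by exact_mod_cast hθ'.le)
    refine le_trans (le_of_eq ?_) h1
    have e : q = (q / (1 - θ) + m - m) * (1 - θ) := by
      rw [add_sub_cancel_right, div_mul_cancel₀ _ hθ'.ne']
    conv_lhs => rw [e]
    rw [EReal.coe_mul, EReal.coe_sub]
    rfl
  obtain ⟨s, hs, hsq⟩ := by simpa only [assouadDim, iInf_lt_iff] using hlt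
  refine ⟨s, hs, ?_⟩
  rw [EReal.coe_lt_coe_iff] at hsq
  rw [← le_div_iff₀ hθ']
  linarith

theorem exists_isSpectrumExponent {m : ℕ} {θ q : ℝ}
    (h : upperAssouadSpectrum θ F - (m : EReal) < (q : EReal)) :
    ∃ t, IsSpectrumExponent θ F t ∧ t - m ≤ q := by
  have hlt : upperAssouadSpectrum θ F < ((q + m : ℝ) : EReal) := by
    by_contra! hle
    refine h.not_ge ?_
    have h1 := EReal.sub_le_sub hle (le_refl (m : EReal))
    refine le_trans (le_of_eq ?_) h1
    conv_lhs => rw [show q = q + m - m by ring]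
    rw [EReal.coe_sub]
    rfl
  obtain ⟨t, ht, htq⟩ := by simpa only [upperAssouadSpectrum, iInf_lt_iff] using hlt
  refine ⟨t, ht, ?_⟩
  rw [EReal.coe_lt_coe_iff] at htq
  linarith

end Exponents

/-- The bound for the loss of dimension under projection. -/
noncomputable def dimensionDrop {X : Type*} [MetricSpace X] (m : ℕ) (θ : ℝ) (F : Set X) : EReal :=
  max 0 (max (upperAssouadSpectrum θ F - (m : EReal))
    ((assouadDim F - (m : EReal)) * ((1 - θ : ℝ) : EReal)))

theorem dimensionDrop_ne_bot {X : Type*} [MetricSpace X] (m : ℕ) (θ : ℝ) (F : Set X) :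
    dimensionDrop m θ F ≠ ⊥ :=
  ((EReal.bot_lt_zero).trans_le (le_max_left _ _)).ne'

/-- Admissible exponents of `F` serve every subset `E`, so a single loss `q` applies to all the
pieces in the packing argument. -/
theorem ae_eventually_boxRatio_le {n m : ℕ} (hm : 1 ≤ m) (h : m ≤ n) {θ : ℝ} (hθ₀ : 0 < θ)
    (hθ₁ : θ < 1) {E F : Set (Euc n)} (hEF : E ⊆ F) (hE : Bornology.IsBounded E)
    (hEne : E.Nonempty) {q : ℝ} (hq : dimensionDrop m θ F < (q : EReal)) :
    ∀ᵐ V ∂(grassmannMeasure h), ∀ᶠ r in 𝓝[>] (0 : ℝ),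
      boxRatio E r ≤ (q : EReal) + boxRatio (V.proj '' E) r := by
  obtain ⟨M, hdM, hMq⟩ := EReal.exists_between_coe_real hq
  obtain ⟨hM, hdM'⟩ := max_lt_iff.mp hdM
  obtain ⟨hM1, hM2⟩ := max_lt_iff.mp hdM'
  obtain ⟨s, hs, hsM⟩ := exists_isAssouadExponent hθ₁ hM2
  obtain ⟨t, ht, htM⟩ := exists_isSpectrumExponent hM1
  have hM0 : (0 : ℝ) < M := by exact_mod_cast hM
  have hMq' : M < q := by exact_mod_cast hMq
  filter_upwards [ae_eventually_coveringNumber_le hm h hθ₀ hθ₁ hE hEne (hs.mono hEF)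
    (ht.mono hEF) hM0.le htM hsM hMq'] with V hV
  exact eventually_boxRatio_le_add (by linarith) hV

/-! ### Packing dimension of projections -/

section SigmaBox

variable {X : Type*} [MetricSpace X]

/-- `E` is covered by countably many compact sets of upper box dimension at most `s`. -/
def SigmaBoxLE (s : EReal) (E : Set X) : Prop :=
  ∃ A : ℕ → Set X, (∀ j, IsCompact (A j)) ∧ E ⊆ (⋃ j, A j) ∧ ∀ j, upperBoxDim (A j) ≤ s

theorem SigmaBoxLE.mono {s : EReal} {E F : Set X} (h : SigmaBoxLE s F) (hEF : E ⊆ F) :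
    SigmaBoxLE s E := by
  obtain ⟨A, hA, hFA, hs⟩ := h
  exact ⟨A, hA, hEF.trans hFA, hs⟩

theorem SigmaBoxLE.iUnion {ι : Type*} [Countable ι] [Nonempty ι] {s : EReal} {E : ι → Set X}
    (h : ∀ i, SigmaBoxLE s (E i)) : SigmaBoxLE s (⋃ i, E i) := by
  choose A hA hEA hs using h
  obtain ⟨g, hg⟩ := exists_surjective_nat (ι × ℕ)
  refine ⟨fun j => A (g j).1 (g j).2, fun j => hA _ _, iUnion_subset fun i x hx => ?_,
    fun j => hs _ _⟩
  obtain ⟨k, hk⟩ := mem_iUnion.mp (hEA i hx)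
  obtain ⟨j, hj⟩ := hg (i, k)
  exact mem_iUnion.mpr ⟨j, by simpa [hj] using hk⟩

theorem SigmaBoxLE.packingDim_le {s : EReal} {E : Set X} (h : SigmaBoxLE s E) :
    packingDim E ≤ s := by
  obtain ⟨A, hA, hEA, hs⟩ := h
  exact (iInf₂_le A ⟨hA, hEA⟩).trans (iSup_le hs)

/-- Closing the sets of a finite cover keeps diameters and covers the closure; infinite covers count
as `⊤`. -/
theorem coveringNumber_closure_le (r : ℝ) (E : Set X) :
    coveringNumber r (closure E) ≤ coveringNumber r E := by
  refine le_iInf₂ fun 𝒰 h𝒰 => ?_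
  by_cases hfin : 𝒰.Finite
  · have hcov : (∀ U ∈ closure '' 𝒰, Metric.ediam U ≤ ENNReal.ofReal r) ∧
        closure E ⊆ ⋃₀ (closure '' 𝒰) := by
      refine ⟨?_, ?_⟩
      · rintro _ ⟨U, hU, rfl⟩
        rw [Metric.ediam_closure]
        exact h𝒰.1 U hU
      · rw [Set.sUnion_image, ← hfin.closure_sUnion]
        exact closure_mono h𝒰.2
    have hle : coveringNumber r (closure E) ≤ (closure '' 𝒰).encard := iInf₂_le (closure '' 𝒰) hcov
    exact hle.trans (Set.encard_image_le _ _)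
  · rw [Set.Infinite.encard_eq hfin]
    exact le_top

theorem upperBoxDim_closure_le (E : Set X) : upperBoxDim (closure E) ≤ upperBoxDim E :=
  limsup_le_limsup (eventually_pos_lt_one.mono fun r hr =>
    boxRatio_mono hr.1 hr.2 (coveringNumber_closure_le r E))

theorem lt_upperBoxDim_of_not_sigmaBoxLE [ProperSpace X] {s : EReal} {E : Set X}
    (hE : Bornology.IsBounded E) (h : ¬ SigmaBoxLE s E) : s < upperBoxDim E := by
  by_contra! hle
  exact h ⟨fun _ => closure E, fun _ => hE.isCompact_closure,
    fun x hx => mem_iUnion.mpr ⟨0, subset_closure hx⟩,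
    fun _ => (upperBoxDim_closure_le E).trans hle⟩

/-- The points of `Z` all of whose neighbourhoods have large image under `f`. -/
def condensation {Z : Type*} [TopologicalSpace Z] [SecondCountableTopology Z] (f : Z → X)
    (s : EReal) : Set Z :=
  {z | ∀ b ∈ TopologicalSpace.countableBasis Z, z ∈ b → ¬ SigmaBoxLE s (f '' b)}

variable {Z : Type*} [TopologicalSpace Z] [SecondCountableTopology Z]

theorem isClosed_condensation (f : Z → X) (s : EReal) : IsClosed (condensation f s) := by
  rw [← isOpen_compl_iff, isOpen_iff_forall_mem_open]
  intro z hz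
  simp only [condensation, mem_compl_iff, mem_ofPred_eq, not_forall, not_not] at hz
  obtain ⟨b, hb, hzb, hsb⟩ := hz
  exact ⟨b, fun w hw hw' => hw' b hb hw hsb, TopologicalSpace.isOpen_of_mem_countableBasis hb, hzb⟩

/-- The discarded part of `U` lies in countably many basic sets with small image, so discarding it
cannot make a large image small. -/
theorem not_sigmaBoxLE_image_inter_condensation {f : Z → X} {s : EReal} {U : Set Z}
    (h : ¬ SigmaBoxLE s (f '' U)) : ¬ SigmaBoxLE s (f '' (U ∩ condensation f s)) := by
  intro hU
  set B := {b // b ∈ TopologicalSpace.countableBasis Z ∧ SigmaBoxLE s (f '' b)}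
  have : Countable B :=
    ((TopologicalSpace.countable_countableBasis Z).mono fun b hb => hb.1).to_subtype
  refine h ((SigmaBoxLE.iUnion (ι := Option B)
    (E := fun o => o.elim (f '' (U ∩ condensation f s)) fun b => f '' b.1) ?_).mono ?_)
  · rintro (_ | b)
    · exact hU
    · exact b.2.2
  · rintro _ ⟨z, hz, rfl⟩
    by_cases hzc : z ∈ condensation f s
    · exact mem_iUnion.mpr ⟨none, z, ⟨hz, hzc⟩, rfl⟩
    · simp only [condensation, mem_ofPred_eq, not_forall, not_not] at hzc
      obtain ⟨b, hb, hzb, hsb⟩ := hzc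
      exact mem_iUnion.mpr ⟨some ⟨b, hb, hsb⟩, z, hzb, rfl⟩

end SigmaBox

theorem ae_le_packingDim_add {n m : ℕ} (hm : 1 ≤ m) (h : m ≤ n) {θ : ℝ} (hθ₀ : 0 < θ)
    (hθ₁ : θ < 1) {f : (ℕ → ℕ) → Euc n} (hf : Continuous f) {s : EReal}
    (hs : s < packingDim (range f)) {q : ℝ} (hq : dimensionDrop m θ (range f) < (q : EReal)) :
    ∀ᵐ V ∂(grassmannMeasure h), s ≤ packingDim (V.proj '' range f) + q := by
  set Z := condensation f s with hZ
  -- One null set serves all the pieces because the basis is countable; it is fixed before any cover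
  -- is chosen.
  have hae : ∀ᵐ V ∂(grassmannMeasure h), ∀ b ∈ TopologicalSpace.countableBasis (ℕ → ℕ),
      (f '' (b ∩ Z)).Nonempty → Bornology.IsBounded (f '' (b ∩ Z)) →
      upperBoxDim (f '' (b ∩ Z)) ≤ upperBoxDim (V.proj '' (f '' (b ∩ Z))) + q := by
    rw [ae_ball_iff (TopologicalSpace.countable_countableBasis _)]
    intro b _
    by_cases hne : (f '' (b ∩ Z)).Nonempty
    · by_cases hbd : Bornology.IsBounded (f '' (b ∩ Z))
      · filter_upwards [ae_eventually_boxRatio_le hm h hθ₀ hθ₁ (image_subset_range _ _) hbd hne hq]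
          with V hV _ _
        exact upperBoxDim_le_add hV
      · exact Eventually.of_forall fun V _ hbd' => absurd hbd' hbd
    · exact Eventually.of_forall fun V hne' => absurd hne' hne
  have hZne : Z.Nonempty := by
    have h0 : ¬ SigmaBoxLE s (f '' univ) := by
      rw [image_univ]
      exact fun hσ => hσ.packingDim_le.not_gt hs
    by_contra hemp
    rw [not_nonempty_iff_eq_empty] at hemp
    have h1 := not_sigmaBoxLE_image_inter_condensation h0
    rw [← hZ, hemp, inter_empty, image_empty] at h1
    -- The point `0` only supplies some basic set with small image, hence a witness that the empty
    -- set is small.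
    have h2 : (0 : ℕ → ℕ) ∉ Z := hemp ▸ notMem_empty _
    simp only [hZ, condensation, mem_ofPred_eq, not_forall, not_not] at h2
    obtain ⟨b, -, -, hsb⟩ := h2
    exact h1 (hsb.mono (empty_subset _))
  have hZcl : IsClosed Z := isClosed_condensation f s
  have : PolishSpace Z := hZcl.polishSpace
  have : Nonempty Z := hZne.to_subtype
  filter_upwards [hae] with V hV
  rw [← EReal.sub_le_iff_le_add (Or.inl (EReal.coe_ne_bot _)) (Or.inl (EReal.coe_ne_top _))]
  refine le_iInf₂ fun A hA => ?_
  have hfZ : Continuous fun z : Z => V.proj (f z) :=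
    V.proj.continuous.comp (hf.comp continuous_subtype_val)
  -- Baire's theorem in the Polish space `Z`: countably many closed preimages cover it, so one has
  -- interior.
  obtain ⟨j, z₀, hz₀⟩ := nonempty_interior_of_iUnion_of_closed
    (f := fun j => (fun z : Z => V.proj (f z)) ⁻¹' A j)
    (fun j => (hA.1 j).isClosed.preimage hfZ) (by
      rw [← preimage_iUnion, eq_univ_iff_forall]
      exact fun z => hA.2 (mem_image_of_mem _ (mem_range_self _)))
  refine le_trans ?_ (le_iSup _ j)
  obtain ⟨W, hWsub, hWo, hzW⟩ := mem_interior.mp hz₀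
  obtain ⟨O, hO, rfl⟩ := isOpen_induced_iff.mp hWo
  -- Intersecting with the preimage of a ball makes the image bounded, as the box estimate requires.
  obtain ⟨b, hb, hzb, hbsub⟩ :=
    (TopologicalSpace.isBasis_countableBasis (ℕ → ℕ)).exists_subset_of_mem_open
      (show (z₀ : ℕ → ℕ) ∈ O ∩ f ⁻¹' Metric.ball (f z₀) 1 from
      ⟨hzW, Metric.mem_ball_self one_pos⟩) (hO.inter (Metric.isOpen_ball.preimage hf))
  have hbd : Bornology.IsBounded (f '' (b ∩ Z)) := by
    refine (Metric.isBounded_ball (x := f z₀) (r := 1)).subset ?_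
    rintro _ ⟨z, hz, rfl⟩
    exact (hbsub hz.1).2
  have hlt : s < upperBoxDim (f '' (b ∩ Z)) :=
    lt_upperBoxDim_of_not_sigmaBoxLE hbd
      (not_sigmaBoxLE_image_inter_condensation (z₀.2 b hb hzb))
  have hsub : V.proj '' (f '' (b ∩ Z)) ⊆ A j := by
    rintro _ ⟨_, ⟨z, hz, rfl⟩, rfl⟩
    exact hWsub (show (⟨z, hz.2⟩ : Z) ∈ Subtype.val ⁻¹' O from (hbsub hz.1).1)
  refine EReal.sub_le_of_le_add (hlt.le.trans ?_)
  refine (hV b hb ⟨f z₀, z₀, ⟨hzb, z₀.2⟩, rfl⟩ hbd).trans ?_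
  gcongr
  exact upperBoxDim_mono hsub

end ProjDim

/-! ### Assembly of the three inequalities -/

theorem theorem1p1 (n m : ℕ) (hm : 1 ≤ m) (hmn : m < n) (θ : ℝ) (hθ₀ : 0 < θ) (hθ₁ : θ < 1)
    (F : Set (EuclideanSpace ℝ (Fin n))) (hF : F.Nonempty) :
    (Bornology.IsBounded F →
      (∀ᵐ V ∂(grassmannMeasure hmn.le),
        upperBoxDim (V.proj '' F) ≥ upperBoxDim F -
          max 0 (max (upperAssouadSpectrum θ F - (m : EReal))
            ((assouadDim F - (m : EReal)) * ((1 - θ : ℝ) : EReal)))) ∧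
      (∀ᵐ V ∂(grassmannMeasure hmn.le),
        lowerBoxDim (V.proj '' F) ≥ lowerBoxDim F -
          max 0 (max (upperAssouadSpectrum θ F - (m : EReal))
            ((assouadDim F - (m : EReal)) * ((1 - θ : ℝ) : EReal))))) ∧
    (MeasurableSet F →
      ∀ᵐ V ∂(grassmannMeasure hmn.le),
        packingDim (V.proj '' F) ≥ packingDim F -
          max 0 (max (upperAssouadSpectrum θ F - (m : EReal))
            ((assouadDim F - (m : EReal)) * ((1 - θ : ℝ) : EReal)))) := by
  have hbot := dimensionDrop_ne_bot m θ F
  refine ⟨fun hb => ?_, fun hmeas => ?_⟩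
  · have hbox : ∀ᵐ V ∂(grassmannMeasure hmn.le), ∀ q : ℚ,
        dimensionDrop m θ F < ((q : ℝ) : EReal) → ∀ᶠ r in 𝓝[>] (0 : ℝ),
          boxRatio F r ≤ ((q : ℝ) : EReal) + boxRatio (V.proj '' F) r := by
      refine ae_all_iff.mpr fun q => ?_
      by_cases hq : dimensionDrop m θ F < ((q : ℝ) : EReal)
      · filter_upwards [ae_eventually_boxRatio_le hm hmn.le hθ₀ hθ₁ subset_rfl hb hF hq]
          with V hV _ using hV
      · exact Eventually.of_forall fun V hq' => absurd hq' hq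
    refine ⟨?_, ?_⟩
    · filter_upwards [hbox] with V hV
      exact sub_le_of_forall_rat_lt hbot fun q hq => upperBoxDim_le_add (hV q hq)
    · filter_upwards [hbox] with V hV
      exact sub_le_of_forall_rat_lt hbot fun q hq => lowerBoxDim_le_add (hV q hq)
  -- A nonempty Borel set is a continuous image of `ℕ → ℕ`, which supplies the complete space for
  -- Baire's theorem.
  · have han := hmeas.analyticSet
    rw [AnalyticSet] at han
    obtain rfl | ⟨f, hf, rfl⟩ := han
    · exact absurd hF not_nonempty_empty
    have hpack : ∀ᵐ V ∂(grassmannMeasure hmn.le), ∀ q s : ℚ,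
        dimensionDrop m θ (range f) < ((q : ℝ) : EReal) →
        ((s : ℝ) : EReal) < packingDim (range f) →
        ((s : ℝ) : EReal) ≤ packingDim (V.proj '' range f) + ((q : ℝ) : EReal) := by
      refine ae_all_iff.mpr fun q => ae_all_iff.mpr fun s => ?_
      by_cases hq : dimensionDrop m θ (range f) < ((q : ℝ) : EReal)
      · by_cases hs : ((s : ℝ) : EReal) < packingDim (range f)
        · filter_upwards [ae_le_packingDim_add hm hmn.le hθ₀ hθ₁ hf hs hq] with V hV _ _ using hV
        · exact Eventually.of_forall fun V _ hs' => absurd hs' hs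
      · exact Eventually.of_forall fun V hq' => absurd hq' hq
    filter_upwards [hpack] with V hV
    refine sub_le_of_forall_rat_lt hbot fun q hq => ?_
    by_contra! hlt
    obtain ⟨s, hs1, hs2⟩ := EReal.lt_iff_exists_rat_btwn.mp hlt
    exact hs1.not_ge (hV q s hq hs2)
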